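/- **Setting.** Let $M$ be a Markov decision process with finite state space $\mathcal S$, finite action space $\mathcal A$, transition probabilities $P(\cdot\mid s,a)$, rewards $r(s,a)\in[0,1]$ and discount factor $\gamma\in[0,1)$. For a stationary stochastic policy $\pi$ let $Q^\pi(s,a)=\mathbb E[\sum_{t\ge0}\gamma^t r(s_t,a_t)\mid \pi,s_0=s,a_0=a]$, $V^\pi(s)=\mathbb E[\sum_{t\ge0}\gamma^t r(s_t,a_t)\mid\pi,s_0=s]$, $V^\pi(\rho)=\mathbb E_{s\sim\rho}V^\pi(s)$ and $A^\pi=Q^\pi-V^\pi$. For a state distribution $\rho$ and a state-action distribution $\nu$ let $d^\pi_\rho(s)=(1-\gamma)\sum_{t\ge0}\gamma^t\Pr^\pi(s_t=s\mid s_0\sim\rho)$ and $d^\pi_\nu(s,a)=(1-\gamma)\sum_{t\ge0}\gamma^t\Pr^\pi(s_t=s,a_t=a\mid (s_0,a_0)\sim\nu)$. Let $\{\pi_\theta:\theta\in\mathbb R^d\}$ be a policy class such that, for all $s,a$, $\pi_\theta(a\mid s)>0$ for every $\theta$ and $\theta\mapsto\log\pi_\theta(a\mid s)$ is differentiable with $\beta$-Lipschitz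 gradient (Euclidean norm, $\beta>0$), and such that $\pi_0$ is the uniform policy at every state. Fix $\rho$, $\nu$, an arbitrary comparator policy $\pi^\star$, and $W>0$. Put $d^\star(s,a)=d_\rho^{\pi^\star}(s)\,\pi^\star(a\mid s)$ and, for a state-action distribution $\upsilon$, $$L_A(w;\theta,\upsilon)=\mathbb E_{(s,a)\sim\upsilon}\big[(A^{\pi_\theta}(s,a)-w\cdot\nabla_\theta\log\pi_\theta(a\mid s))^2\big],\qquad \Sigma^\theta_\upsilon=\mathbb E_{(s,a)\sim\upsilon}\big[\nabla_\theta\log\pi_\theta(a\mid s)\,\nabla_\theta\log\pi_\theta(a\mid s)^\top\big].$$ **Sampler** (for a policy $\pi$). Draw $(s_0,a_0)\sim\nu$. At each time step $h\ge0$, with probability $\gamma$ execute $a_h$, observe $s_{h+1}\sim P(\cdot\mid s_h,a_h)$ and draw $a_{h+1}\sim\pi(\cdot\mid s_{h+1})$; otherwise accept $(s,a)=(s_h,a_h)$. Then set $\widehat Q=\widehat V=0$ and toss a fair coin. On heads, execute $a$ at $s$ and continue with $\pi$, terminating with probability $1-\gamma$ after each executed action, and let $\widehat Q$ be the undiscounted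 sum of the rewards collected. On tails, draw $a'\sim\pi(\cdot\mid s)$, do the same starting with $a'$ at $s$, and let $\widehat V$ be the sum of the rewards. Return $(s,a)$ and $\widehat A=2(\widehat Q-\widehat V)$. Each state drawn from the environment (the initial state and the successor state of every executed action) counts as one sample; the length of the episode is its number of samples. **Sample-based NPG.** Set $\theta^{(0)}=0$. For $t=0,\dots,T-1$: set $w_0=0$; for $n=0,\dots,N-1$ call the sampler for $\pi_{\theta^{(t)}}$ (with fresh randomness) to get $(s,a)$ and $\widehat A$, and set $$w_{n+1}=\mathrm{Proj}_{\{\|w\|_2\le W\}}\big(w_n-2\alpha\,(w_n\cdot\nabla_\theta\log\pi_{\theta^{(t)}}(a\mid s)-\widehat A)\,\nabla_\theta\log\pi_{\theta^{(t)}}(a\mid s)\big);$$ then set $\widehat w^{(t)}=\frac1N\sum_{n=1}^N w_n$ and $\theta^{(t+1)}=\theta^{(t)}+\eta\,\widehat w^{(t)}$. Write $V^{(t)}=V^{\pi_{\theta^{(t)}}}$. **Claim.** Let $T,N\ge1$ and $B\in\mathbb R$, and let $\eta=\sqrt{2\log|\mathcal A|/(\beta W^2T)}$. There is a step size $\alpha>0$,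 depending only on $|\mathcal A|,d,\gamma,\beta,W,B,T,N$, such that the following holds for every such MDP, policy class, $\rho$, $\nu$, $\pi^\star$ and all $\kappa,\varepsilon_{\rm bias}\ge0$. Suppose that the run of sample-based NPG with $\eta,\alpha$ satisfies, for all $t<T$: 1. with probability one, $\|\nabla_\theta\log\pi_{\theta^{(t)}}(a\mid s)\|_2\le B$ for all $s,a$; 2. (transfer error) $\mathbb E\big[L_A(w_\star^{(t)};\theta^{(t)},d^\star)\big]\le\varepsilon_{\rm bias}$, where $w_\star^{(t)}$, a function of $\theta^{(t)}$, is a choice of a minimizer of $L_A(w;\theta^{(t)},d_\nu^{\pi_{\theta^{(t)}}})$ over $\|w\|_2\le W$; 3. (relative condition number) $\mathbb E\Big[\sup_{w\in\mathbb R^d}\frac{w^\top\Sigma^{\theta^{(t)}}_{d^\star}w}{w^\top\Sigma^{\theta^{(t)}}_{\nu}w}\Big]\le\kappa$, where $0/0=0$ and $c/0=\infty$ for $c>0$. Then $$\mathbb E\Big[\min_{t<T}\big\{V^{\pi^\star}(\rho)-V^{(t)}(\rho)\big\}\Big]\le\frac{W}{1-\gamma}\sqrt{\frac{2\beta\log|\mathcal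 A|}{T}}+\sqrt{\frac{8\kappa BW(BW+1)}{(1-\gamma)^4}}\,\frac1{N^{1/4}}+\frac{\sqrt{\varepsilon_{\rm bias}}}{1-\gamma}.$$ Furthermore, under every policy $\pi_\theta$ an episode of the sampler has expected length $2/(1-\gamma)$, and the expected total number of samples used by the run is $2NT/(1-\gamma)$. -/

import Mathlib

open scoped ENNReal

namespace NPG

noncomputable section

/-! ### Finite discounted Markov decision processes -/

/-- A finite discounted MDP with rewards in `[0,1]`. Start distributions are kept separate. -/
structure MDP (S A : Type*) where
  /-- transition probabilities `P(· | s, a)` -/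
  P : S → A → PMF S
  /-- reward function -/
  r : S → A → ℝ
  r_nonneg : ∀ s a, 0 ≤ r s a
  r_le_one : ∀ s a, r s a ≤ 1
  /-- discount factor -/
  γ : ℝ
  γ_nonneg : 0 ≤ γ
  γ_lt_one : γ < 1

/-- A stochastic stationary policy: `π s` is the law of the action played in state `s`. -/
abbrev Policy (S A : Type*) := S → PMF A

/-- The parameter space `ℝ^d` with its Euclidean norm. -/
abbrev Param (d : ℕ) := EuclideanSpace ℝ (Fin d)

/-- Expectation of a real function of a discrete random variable with law `p`. -/
def mean {α : Type*} (p : PMF α) (f : α → ℝ) : ℝ := ∑' x, (p x).toReal * f x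

/-- Expectation of a `[0,∞]`-valued function of a discrete random variable with law `p`. -/
def lmean {α : Type*} (p : PMF α) (f : α → ℝ≥0∞) : ℝ≥0∞ := ∑' x, p x * f x

section Basic

variable {S A : Type*}

/-- Execute `x.2` in state `x.1`, move to `s' ~ P(· | x)` and choose the next action
`a' ~ π(· | s')`. The result is the next state-action pair. -/
def step (M : MDP S A) (π : Policy S A) (x : S × A) : PMF (S × A) :=
  (M.P x.1 x.2).bind fun s' => (π s').map fun a' => (s', a')

/-- The law of `(s_t, a_t)` when `(s_0, a_0) ~ μ` and `π` is followed thereafter. -/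
def pairLaw (M : MDP S A) (π : Policy S A) (μ : PMF (S × A)) : ℕ → PMF (S × A)
  | 0 => μ
  | t + 1 => (pairLaw M π μ t).bind (step M π)

/-- The law of `(s_0, a_0)` when `s_0 ~ ρ` and `a_0 ~ π(· | s_0)`. -/
def startLaw (π : Policy S A) (ρ : PMF S) : PMF (S × A) :=
  ρ.bind fun s => (π s).map fun a => (s, a)

/-- Expected discounted reward when `(s_0, a_0) ~ μ` and `π` is followed thereafter. -/
def discountedReward (M : MDP S A) (π : Policy S A) (μ : PMF (S × A)) : ℝ :=
  ∑' t : ℕ, M.γ ^ t * mean (pairLaw M π μ t) fun x => M.r x.1 x.2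

/-- The action-value function `Q^π(s, a)`. -/
def Q (M : MDP S A) (π : Policy S A) (s : S) (a : A) : ℝ :=
  discountedReward M π (PMF.pure (s, a))

/-- The value function `V^π(s)`. -/
def V (M : MDP S A) (π : Policy S A) (s : S) : ℝ :=
  discountedReward M π (startLaw π (PMF.pure s))

/-- The value `V^π(ρ) = E_{s ~ ρ} V^π(s)`. -/
def value (M : MDP S A) (π : Policy S A) (ρ : PMF S) : ℝ := mean ρ (V M π)

/-- The advantage function `A^π(s, a) = Q^π(s, a) - V^π(s)`. -/
def adv (M : MDP S A) (π : Policy S A) (s : S) (a : A) : ℝ := Q M π s a - V M π s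

/-- The discounted state visitation distribution
`d_ρ^π(s) = (1 - γ) ∑_t γ^t Pr(s_t = s | s_0 ~ ρ)`. -/
def stateVisit (M : MDP S A) (π : Policy S A) (ρ : PMF S) (s : S) : ℝ :=
  (1 - M.γ) * ∑' t : ℕ, M.γ ^ t * (((pairLaw M π (startLaw π ρ) t).map Prod.fst) s).toReal

/-- The discounted state-action visitation distribution
`d_ν^π(s, a) = (1 - γ) ∑_t γ^t Pr(s_t = s, a_t = a | (s_0, a_0) ~ ν)`. -/
def pairVisit (M : MDP S A) (π : Policy S A) (ν : PMF (S × A)) (x : S × A) : ℝ :=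
  (1 - M.γ) * ∑' t : ℕ, M.γ ^ t * (pairLaw M π ν t x).toReal

/-- The comparator's measure `d^⋆(s, a) = d_ρ^{π⋆}(s) π⋆(a | s)`. -/
def comparatorVisit (M : MDP S A) (π : Policy S A) (ρ : PMF S) (x : S × A) : ℝ :=
  stateVisit M π ρ x.1 * (π x.1 x.2).toReal

/-! ### Parametric policies, compatible loss, Fisher information -/

variable {d : ℕ}

/-- `∇_θ log π_θ(a | s)`. -/
def score (pol : Param d → Policy S A) (θ : Param d) (s : S) (a : A) : Param d :=
  gradient (fun θ' => Real.log (pol θ' s a).toReal) θ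

/-- Each `log π_θ(a | s)` is a well defined (`π_θ(a | s) > 0`), differentiable function of `θ`
on `ℝ^d` with `β`-Lipschitz gradient. -/
def SmoothPolicy (β : ℝ) (pol : Param d → Policy S A) : Prop :=
  ∀ s a, (∀ θ, 0 < pol θ s a) ∧
    Differentiable ℝ (fun θ => Real.log (pol θ s a).toReal) ∧
    ∀ θ θ', ‖score pol θ s a - score pol θ' s a‖ ≤ β * ‖θ - θ'‖

/-- The compatible loss `L_A(w; θ, υ) = E_{(s,a) ~ υ} (A^{π_θ}(s,a) - w · ∇_θ log π_θ(a|s))²`. -/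
def lossA [Fintype S] [Fintype A] (M : MDP S A) (pol : Param d → Policy S A) (w θ : Param d)
    (υ : S × A → ℝ) : ℝ :=
  ∑ x, υ x * (adv M (pol θ) x.1 x.2 - inner ℝ w (score pol θ x.1 x.2)) ^ 2

/-- `w` minimizes `L_A(·; θ, d_ν^{π_θ})` over the ball `‖w‖ ≤ W`. -/
def IsBestFit [Fintype S] [Fintype A] (M : MDP S A) (pol : Param d → Policy S A)
    (ν : PMF (S × A)) (W : ℝ) (θ w : Param d) : Prop :=
  ‖w‖ ≤ W ∧ ∀ w' : Param d, ‖w'‖ ≤ W →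
    lossA M pol w θ (pairVisit M (pol θ) ν) ≤ lossA M pol w' θ (pairVisit M (pol θ) ν)

/-- `Σ_υ^θ = E_{(s,a) ~ υ} [∇_θ log π_θ(a|s) (∇_θ log π_θ(a|s))ᵀ]`. -/
def fisher [Fintype S] [Fintype A] (pol : Param d → Policy S A) (θ : Param d) (υ : S × A → ℝ) :
    Matrix (Fin d) (Fin d) ℝ :=
  ∑ x, υ x • Matrix.vecMulVec (score pol θ x.1 x.2).ofLp (score pol θ x.1 x.2).ofLp

/-- `sup_w (wᵀ X w) / (wᵀ Y w)` for positive semidefinite `X`, `Y`. The quotient is taken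
in `[0,∞]`: it is `∞` if only the denominator vanishes, and `0` if both terms vanish. -/
def relCond (X Y : Matrix (Fin d) (Fin d) ℝ) : ℝ≥0∞ :=
  ⨆ w : Fin d → ℝ,
    ENNReal.ofReal (dotProduct w (X.mulVec w)) / ENNReal.ofReal (dotProduct w (Y.mulVec w))

end Basic

/-! ### Loops with geometric termination -/

/-- The number of rounds before the first failure of independent coins with success
probability `γ`: `Pr(n) = (1 - γ) γ^n`. -/
def roundsLaw (γ : ℝ) (h0 : 0 ≤ γ) (h1 : γ < 1) : PMF ℕ :=
  ⟨fun n => ENNReal.ofReal ((1 - γ) * γ ^ n), by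
    have h : HasSum (fun n : ℕ => (1 - γ) * γ ^ n) 1 := by
      have := (hasSum_geometric_of_lt_one h0 h1).mul_left (1 - γ)
      rwa [mul_inv_cancel₀ (by linarith)] at this
    have h2 := h.toNNReal (fun n => mul_nonneg (by linarith) (pow_nonneg h0 n))
    rw [Real.toNNReal_one] at h2
    exact ENNReal.hasSum_coe.2 h2⟩

/-- The law of the result of `n` successive executions of the random `body`. -/
def iterBody {α : Type*} (body : α → PMF α) : ℕ → α → PMF α
  | 0, x => PMF.pure x
  | n + 1, x => (body x).bind (iterBody body n)

/-- The loop "with probability `γ` execute `body` and repeat, else stop", started at `x`. -/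
def coinLoop {α : Type*} (γ : ℝ) (h0 : 0 ≤ γ) (h1 : γ < 1) (body : α → PMF α) (x : α) : PMF α :=
  (roundsLaw γ h0 h1).bind fun n => iterBody body n x

/-- The loop unrolled once: with probability `1 - γ` it stops at `x`, with probability `γ`
it executes `body` and starts afresh from the result. -/
theorem coinLoop_apply {α : Type*} (γ : ℝ) (h0 : 0 ≤ γ) (h1 : γ < 1) (body : α → PMF α)
    (x y : α) :
    coinLoop γ h0 h1 body x y = ENNReal.ofReal (1 - γ) * PMF.pure x y
      + ENNReal.ofReal γ * ((body x).bind (coinLoop γ h0 h1 body)) y := by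
  have hr : ∀ n, roundsLaw γ h0 h1 (n + 1) = ENNReal.ofReal γ * roundsLaw γ h0 h1 n := by
    intro n
    change ENNReal.ofReal _ = _ * ENNReal.ofReal _
    rw [← ENNReal.ofReal_mul h0]
    congr 1
    ring
  have hz : roundsLaw γ h0 h1 0 = ENNReal.ofReal (1 - γ) := by
    change ENNReal.ofReal _ = _
    simp
  unfold coinLoop
  rw [PMF.bind_comm, PMF.bind_apply, tsum_eq_zero_add' ENNReal.summable, hz, PMF.bind_apply,
    ← ENNReal.tsum_mul_left]
  congr 1
  refine tsum_congr fun n => ?_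
  rw [hr, mul_assoc]
  rfl

section Algorithm

variable {S A : Type*}

/-! ### The sampler for `(s, a) ~ d_ν^π` and an unbiased estimate of `A^π(s, a)`

A sample is one draw of a state from the environment: the start of the episode or the
successor state of an executed action. -/

/-- State of a rollout: the pair to be executed next, the undiscounted sum of the rewards so
far, and the number of samples so far. -/
structure Rollout (S A : Type*) where
  pair : S × A
  ret : ℝ
  samples : ℕ

/-- Execute the current action, collect its reward, observe the next state (one sample), and
choose the next action from `π`. -/
def execute (M : MDP S A) (π : Policy S A) (z : Rollout S A) : PMF (Rollout S A) :=
  (step M π z.pair).map fun x => ⟨x, z.ret + M.r z.pair.1 z.pair.2, z.samples + 1⟩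

/-- From `x`, execute `x.2` in `x.1` and then continue with `π`, with termination
probability `1 - γ` after each executed action; `k` is the number of samples used before. -/
def rollout (M : MDP S A) (π : Policy S A) (x : S × A) (k : ℕ) : PMF (Rollout S A) :=
  (execute M π ⟨x, 0, k⟩).bind (coinLoop M.γ M.γ_nonneg M.γ_lt_one (execute M π))

/-- Output of the sampler: the accepted pair, the estimate of its advantage, and the length
of the episode, i.e. the number of samples used. -/
structure Draw (S A : Type*) where
  pair : S × A
  advHat : ℝ
  samples : ℕ

/-- A fair coin. -/
def fairCoin : PMF Bool := PMF.uniformOfFintype Bool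

/-- The sampler: start at `(s_0, a_0) ~ ν` (one sample); at every time step, with probability
`γ` execute `a_h` and draw the next pair, else accept `(s_h, a_h)`. Then, with probability `1/2`,
roll out from `(s_h, a_h)` to get `Q̂` (and `V̂ = 0`); else draw `a' ~ π(· | s_h)` and roll out
from `(s_h, a')` to get `V̂` (and `Q̂ = 0`). Return `(s_h, a_h)` and `2 (Q̂ - V̂)`. -/
def sampler (M : MDP S A) (π : Policy S A) (ν : PMF (S × A)) : PMF (Draw S A) :=
  ν.bind fun x₀ =>
  (coinLoop M.γ M.γ_nonneg M.γ_lt_one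
    (fun z : (S × A) × ℕ => (step M π z.1).map fun x => (x, z.2 + 1)) (x₀, 1)).bind fun z =>
  fairCoin.bind fun sampleQ =>
  if sampleQ then
    (rollout M π z.1 z.2).map fun o => ⟨z.1, 2 * (o.ret - 0), o.samples⟩
  else
    (π z.1.1).bind fun a' =>
    (rollout M π (z.1.1, a') z.2).map fun o => ⟨z.1, 2 * (0 - o.ret), o.samples⟩

/-! ### Sample-based NPG -/

variable {d : ℕ}

/-- Euclidean projection onto the ball `‖w‖ ≤ W`. -/
def projBall (W : ℝ) (v : Param d) : Param d := if ‖v‖ ≤ W then v else (W / ‖v‖) • v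

/-- The projected SGD update of `w` on a draw `o`, at the policy parameter `θ`. -/
def sgdUpdate (pol : Param d → Policy S A) (W α : ℝ) (θ w : Param d) (o : Draw S A) : Param d :=
  let g := score pol θ o.pair.1 o.pair.2
  projBall W (w - (2 * α * (inner ℝ w g - o.advHat)) • g)

/-- State of the inner loop: the current `w_n`, the sum `w_1 + ⋯ + w_n`, and the number of
samples used. -/
structure SGDState (d : ℕ) where
  cur : Param d
  sum : Param d
  samples : ℕ

/-- The inner loop after `n` steps, started at `w_0 = 0`. -/
def sgdLoop (M : MDP S A) (pol : Param d → Policy S A) (ν : PMF (S × A)) (W α : ℝ)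
    (θ : Param d) : ℕ → PMF (SGDState d)
  | 0 => PMF.pure ⟨0, 0, 0⟩
  | n + 1 => (sgdLoop M pol ν W α θ n).bind fun z =>
      (sampler M (pol θ) ν).map fun o =>
        let w := sgdUpdate pol W α θ z.cur o
        ⟨w, z.sum + w, z.samples + o.samples⟩

/-- A (partial) run of the algorithm: `θ t` is the iterate `θ^{(t)}` for every `t` up to the
number of iterations performed so far; `samples` is the total number of samples used. -/
structure Run (d : ℕ) where
  θ : ℕ → Param d
  samples : ℕ

/-- The law of the run of sample-based NPG after `T` iterations, each with `N` gradient steps: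
`θ^{(0)} = 0` and `θ^{(t+1)} = θ^{(t)} + η ŵ^{(t)}`, where `ŵ^{(t)} = (1/N) ∑_{n=1}^N w_n` comes
from the inner loop at `θ^{(t)}`. -/
def npg (M : MDP S A) (pol : Param d → Policy S A) (ν : PMF (S × A)) (W η α : ℝ) (N : ℕ) :
    ℕ → PMF (Run d)
  | 0 => PMF.pure ⟨fun _ => 0, 0⟩
  | t + 1 => (npg M pol ν W η α N t).bind fun ω =>
      (sgdLoop M pol ν W α (ω.θ t) N).map fun z =>
        ⟨Function.update ω.θ (t + 1) (ω.θ t + η • ((1 / (N : ℝ)) • z.sum)),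
          ω.samples + z.samples⟩

end Algorithm

end

end NPG

/-! The potential is the cross entropy Φ(θ) of π_θ relative to the comparator, averaged over d⋆. It
differs from the relative entropy by a constant, starts at log|A| because π_0 is uniform, and is
never negative. Since log π_θ has a β-Lipschitz gradient, a step v changes Φ by at most
-E_{d⋆}[v·∇log π_θ] + (β/2)‖v‖² (`SmoothPolicy.crossEntropy_add_le`).

The linear term is tied to suboptimality by `performance_difference`: (1-γ)(V⋆ - V^θ) is the d⋆-mean
of the advantage. In `suboptimality_le` the advantage is split as ŵ·g + (A - w⋆·g) + (w⋆ - ŵ)·g,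
with g the score. The first part is what the step gains. The second is at most the square root of
the transfer error. For the third, the relative condition number passes from d⋆ to ν, the bound ν ≤
d_ν/(1-γ) passes to d_ν, and first-order optimality of w⋆ over the ball (`IsBestFit.sum_sq_le`)
bounds the result by the excess loss of ŵ.

That excess loss is a matter of projected SGD on a quadratic. The sampler accepts a pair with law
d_ν, and its estimate of the advantage is unbiased with second moment at most 8/(1-γ)²
(`mean_sampler_quadratic_le`). The estimate itself is unbounded, so only moments are used. The
resulting rate is 8BW(BW+1)/((1-γ)√N), uniformly in θ.

Averaging over θ^{(t)} with Jensen's inequality, and telescoping Φ over t, bounds the sum of the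
gaps; the minimum is at most the average, and η balances log|A|/(ηT) against βηW²/2. The sample
counts are means of geometric variables. -/

namespace NPG

/-! ### Expectations under discrete laws -/

section Expectation

variable {ι κ : Type*}

theorem lmean_pure (x : ι) (f : ι → ℝ≥0∞) : lmean (PMF.pure x) f = f x := by
  classical
  unfold lmean
  rw [tsum_eq_single x]
  · simp
  · intro y hy
    simp [hy]

theorem lmean_bind (p : PMF ι) (q : ι → PMF κ) (f : κ → ℝ≥0∞) :
    lmean (p.bind q) f = lmean p fun x => lmean (q x) f := by
  unfold lmean
  simp_rw [PMF.bind_apply, ← ENNReal.tsum_mul_right, ← ENNReal.tsum_mul_left]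
  rw [ENNReal.tsum_comm]
  simp_rw [mul_assoc]

theorem lmean_map (p : PMF ι) (g : ι → κ) (f : κ → ℝ≥0∞) :
    lmean (p.map g) f = lmean p fun x => f (g x) := by
  rw [← PMF.bind_pure_comp, lmean_bind]
  simp [lmean_pure]

theorem lmean_mono {p : PMF ι} {f g : ι → ℝ≥0∞} (h : ∀ x ∈ p.support, f x ≤ g x) :
    lmean p f ≤ lmean p g := by
  refine ENNReal.tsum_le_tsum fun x => ?_
  by_cases hx : p x = 0
  · simp [hx]
  · exact mul_le_mul_right (h x hx) _

theorem lmean_congr {p : PMF ι} {f g : ι → ℝ≥0∞} (h : ∀ x ∈ p.support, f x = g x) :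
    lmean p f = lmean p g :=
  le_antisymm (lmean_mono fun x hx => (h x hx).le) (lmean_mono fun x hx => (h x hx).ge)

theorem lmean_const (p : PMF ι) (c : ℝ≥0∞) : lmean p (fun _ => c) = c := by
  unfold lmean
  rw [ENNReal.tsum_mul_right, p.tsum_coe, one_mul]

theorem lmean_add (p : PMF ι) (f g : ι → ℝ≥0∞) :
    lmean p (fun x => f x + g x) = lmean p f + lmean p g := by
  unfold lmean
  simp_rw [mul_add]
  exact ENNReal.tsum_add

theorem lmean_const_mul (p : PMF ι) (c : ℝ≥0∞) (f : ι → ℝ≥0∞) :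
    lmean p (fun x => c * f x) = c * lmean p f := by
  unfold lmean
  simp_rw [mul_left_comm _ c]
  exact ENNReal.tsum_mul_left

/-- The expectation of `f` under `p` converges absolutely. -/
def HasMean (p : PMF ι) (f : ι → ℝ) : Prop := lmean p (fun x => ‖f x‖ₑ) ≠ ⊤

theorem enorm_weight_mul (p : PMF ι) (f : ι → ℝ) (x : ι) :
    ‖(p x).toReal * f x‖ₑ = p x * ‖f x‖ₑ := by
  rw [enorm_mul, Real.enorm_of_nonneg ENNReal.toReal_nonneg, ENNReal.ofReal_toReal (p.apply_ne_top x)]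

theorem summable_of_tsum_enorm_ne_top {f : ι → ℝ} (h : ∑' x, ‖f x‖ₑ ≠ ⊤) : Summable f := by
  refine Summable.of_norm ?_
  have := ENNReal.summable_toReal h
  simpa using this

theorem HasMean.summable {p : PMF ι} {f : ι → ℝ} (h : HasMean p f) :
    Summable fun x => (p x).toReal * f x := by
  refine summable_of_tsum_enorm_ne_top ?_
  simp_rw [enorm_weight_mul]
  exact h

theorem HasMean.mono {p : PMF ι} {f g : ι → ℝ} (hg : HasMean p g)
    (h : ∀ x ∈ p.support, |f x| ≤ g x) : HasMean p f := by
  refine ne_top_of_le_ne_top hg (lmean_mono fun x hx => ?_)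
  rw [Real.enorm_eq_ofReal_abs, Real.enorm_eq_ofReal_abs]
  exact ENNReal.ofReal_le_ofReal ((h x hx).trans (le_abs_self _))

theorem hasMean_const (p : PMF ι) (c : ℝ) : HasMean p fun _ => c := by
  unfold HasMean
  rw [lmean_const]
  exact enorm_ne_top

theorem HasMean.of_bounded {p : PMF ι} {f : ι → ℝ} {c : ℝ} (h : ∀ x ∈ p.support, |f x| ≤ c) :
    HasMean p f := (hasMean_const p c).mono h

theorem HasMean.of_finite [Finite ι] (p : PMF ι) (f : ι → ℝ) : HasMean p f := by
  obtain ⟨c, hc⟩ := (Set.finite_range fun x => |f x|).bddAbove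
  exact .of_bounded (c := c) fun x _ => hc ⟨x, rfl⟩

theorem HasMean.add {p : PMF ι} {f g : ι → ℝ} (hf : HasMean p f) (hg : HasMean p g) :
    HasMean p fun x => f x + g x := by
  refine ne_top_of_le_ne_top (ENNReal.add_ne_top.2 ⟨hf, hg⟩) ?_
  rw [← lmean_add]
  exact lmean_mono fun x _ => enorm_add_le _ _

theorem HasMean.const_mul {p : PMF ι} {f : ι → ℝ} (hf : HasMean p f) (c : ℝ) :
    HasMean p fun x => c * f x := by
  unfold HasMean
  simp_rw [enorm_mul, lmean_const_mul]
  exact ENNReal.mul_ne_top enorm_ne_top hf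

theorem HasMean.sub {p : PMF ι} {f g : ι → ℝ} (hf : HasMean p f) (hg : HasMean p g) :
    HasMean p fun x => f x - g x := by
  simpa [sub_eq_add_neg] using hf.add (hg.const_mul (-1))

theorem HasMean.sum {τ : Type*} {p : PMF ι} {f : τ → ι → ℝ} (s : Finset τ)
    (hf : ∀ i ∈ s, HasMean p (f i)) : HasMean p fun x => ∑ i ∈ s, f i x := by
  classical
  induction s using Finset.induction_on with
  | empty => simpa using hasMean_const p 0
  | insert a s ha ih =>
    simp_rw [Finset.sum_insert ha]
    exact (hf a (by simp)).add (ih fun i hi => hf i (by simp [hi]))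

theorem HasMean.of_sq {p : PMF ι} {f : ι → ℝ} (hf : HasMean p fun x => f x ^ 2) : HasMean p f := by
  refine ((hasMean_const p 1).add hf).mono fun x _ => ?_
  rw [← sq_abs]
  nlinarith [sq_nonneg (|f x| - 1), abs_nonneg (f x)]

theorem HasMean.bind_iff {p : PMF ι} {q : ι → PMF κ} {f : κ → ℝ} :
    HasMean (p.bind q) f ↔ lmean p (fun x => lmean (q x) fun y => ‖f y‖ₑ) ≠ ⊤ := by
  unfold HasMean
  rw [lmean_bind]

theorem HasMean.map_iff {p : PMF ι} {g : ι → κ} {f : κ → ℝ} :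
    HasMean (p.map g) f ↔ HasMean p fun x => f (g x) := by
  unfold HasMean
  rw [lmean_map]

/-- An infinite conditional expectation at one point of positive mass would already make the total
infinite. -/
theorem HasMean.of_bind {p : PMF ι} {q : ι → PMF κ} {f : κ → ℝ} (h : HasMean (p.bind q) f)
    {x : ι} (hx : x ∈ p.support) : HasMean (q x) f := by
  rw [HasMean.bind_iff] at h
  intro ht
  refine h (ENNReal.tsum_eq_top_of_eq_top ⟨x, ?_⟩)
  change p x * lmean (q x) (fun y => ‖f y‖ₑ) = ⊤
  rw [ht]
  exact ENNReal.mul_top hx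

/-- Fubini for the double series. Absolute convergence has to be assumed: a divergent `tsum` is 0,
and the identity could then fail. The `[0,∞]`-valued counterpart `lmean_bind` needs no condition,
which is why integrability is always proved through `lmean`. -/
theorem mean_bind {p : PMF ι} {q : ι → PMF κ} {f : κ → ℝ} (h : HasMean (p.bind q) f) :
    mean (p.bind q) f = mean p fun x => mean (q x) f := by
  have hs : Summable fun z : ι × κ => (p z.1).toReal * ((q z.1 z.2).toReal * f z.2) := by
    refine summable_of_tsum_enorm_ne_top ?_
    rw [HasMean.bind_iff] at h
    convert h using 1
    rw [ENNReal.tsum_prod']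
    refine tsum_congr fun x => ?_
    dsimp only
    rw [lmean, ← ENNReal.tsum_mul_left]
    refine tsum_congr fun y => ?_
    rw [enorm_weight_mul p fun _ => (q x y).toReal * f y, enorm_weight_mul]
  unfold mean
  calc ∑' y, ((p.bind q) y).toReal * f y
      = ∑' y, ∑' x, (p x).toReal * ((q x y).toReal * f y) := by
        refine tsum_congr fun y => ?_
        rw [PMF.bind_apply, ENNReal.tsum_toReal_eq
          fun x => ENNReal.mul_ne_top (p.apply_ne_top x) ((q x).apply_ne_top y), ← tsum_mul_right]
        simp_rw [ENNReal.toReal_mul, mul_assoc]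
    _ = ∑' x, ∑' y, (p x).toReal * ((q x y).toReal * f y) := Summable.tsum_comm hs
    _ = _ := by simp_rw [tsum_mul_left]

theorem HasMean.bind_mean {p : PMF ι} {q : ι → PMF κ} {f : κ → ℝ} (h : HasMean (p.bind q) f) :
    HasMean p fun x => mean (q x) f := by
  rw [HasMean.bind_iff] at h
  refine ne_top_of_le_ne_top h (lmean_mono fun x _ => ?_)
  unfold mean lmean
  simp_rw [← enorm_weight_mul]
  exact enorm_tsum_le_tsum_enorm

theorem mean_pure (x : ι) (f : ι → ℝ) : mean (PMF.pure x) f = f x := by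
  classical
  unfold mean
  rw [tsum_eq_single x]
  · simp
  · intro y hy
    simp [hy]

theorem mean_map {p : PMF ι} {g : ι → κ} {f : κ → ℝ} (h : HasMean p fun x => f (g x)) :
    mean (p.map g) f = mean p fun x => f (g x) := by
  rw [← HasMean.map_iff, ← PMF.bind_pure_comp] at h
  rw [← PMF.bind_pure_comp, mean_bind h]
  simp [mean_pure]

theorem mean_mono {p : PMF ι} {f g : ι → ℝ} (hf : HasMean p f) (hg : HasMean p g)
    (h : ∀ x ∈ p.support, f x ≤ g x) : mean p f ≤ mean p g := by
  refine Summable.tsum_le_tsum (fun x => ?_) hf.summable hg.summable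
  by_cases hx : p x = 0
  · simp [hx]
  · exact mul_le_mul_of_nonneg_left (h x hx) ENNReal.toReal_nonneg

theorem mean_congr {p : PMF ι} {f g : ι → ℝ} (h : ∀ x ∈ p.support, f x = g x) :
    mean p f = mean p g := by
  refine tsum_congr fun x => ?_
  by_cases hx : p x = 0
  · simp [hx]
  · rw [h x hx]

theorem mean_const (p : PMF ι) (c : ℝ) : mean p (fun _ => c) = c := by
  unfold mean
  rw [tsum_mul_right, ← ENNReal.tsum_toReal_eq p.apply_ne_top, p.tsum_coe]
  simp

theorem mean_add {p : PMF ι} {f g : ι → ℝ} (hf : HasMean p f) (hg : HasMean p g) :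
    mean p (fun x => f x + g x) = mean p f + mean p g := by
  unfold mean
  simp_rw [mul_add]
  exact hf.summable.tsum_add hg.summable

theorem mean_const_mul (p : PMF ι) (c : ℝ) (f : ι → ℝ) :
    mean p (fun x => c * f x) = c * mean p f := by
  unfold mean
  simp_rw [mul_left_comm _ c]
  exact tsum_mul_left

theorem mean_sub {p : PMF ι} {f g : ι → ℝ} (hf : HasMean p f) (hg : HasMean p g) :
    mean p (fun x => f x - g x) = mean p f - mean p g := by
  unfold mean
  simp_rw [mul_sub]
  exact hf.summable.tsum_sub hg.summable

theorem mean_sum {τ : Type*} {p : PMF ι} {f : τ → ι → ℝ} (s : Finset τ)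
    (hf : ∀ i ∈ s, HasMean p (f i)) :
    mean p (fun x => ∑ i ∈ s, f i x) = ∑ i ∈ s, mean p (f i) := by
  classical
  induction s using Finset.induction_on with
  | empty => simpa using mean_const p 0
  | insert a s ha ih =>
    simp_rw [Finset.sum_insert ha]
    rw [mean_add (hf a (by simp)) (.sum s fun i hi => hf i (by simp [hi])),
      ih fun i hi => hf i (by simp [hi])]

theorem mean_nonneg {p : PMF ι} {f : ι → ℝ} (h : ∀ x, 0 ≤ f x) : 0 ≤ mean p f :=
  tsum_nonneg fun x => mul_nonneg ENNReal.toReal_nonneg (h x)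

theorem mean_le_of_le {p : PMF ι} {f : ι → ℝ} {c : ℝ} (hf : HasMean p f)
    (h : ∀ x ∈ p.support, f x ≤ c) : mean p f ≤ c :=
  (mean_mono hf (hasMean_const p c) h).trans_eq (mean_const p c)

theorem le_mean_of_le {p : PMF ι} {f : ι → ℝ} {c : ℝ} (hf : HasMean p f)
    (h : ∀ x ∈ p.support, c ≤ f x) : c ≤ mean p f :=
  (mean_const p c).symm.trans_le (mean_mono (hasMean_const p c) hf h)

theorem mean_eq_sum [Fintype ι] (p : PMF ι) (f : ι → ℝ) :
    mean p f = ∑ x, (p x).toReal * f x := tsum_fintype _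

theorem HasMean.of_lmean_le {p : PMF ι} {f : ι → ℝ} (hf : ∀ x ∈ p.support, 0 ≤ f x) {c : ℝ}
    (h : lmean p (fun x => ENNReal.ofReal (f x)) ≤ ENNReal.ofReal c) : HasMean p f := by
  refine ne_top_of_le_ne_top ENNReal.ofReal_ne_top ((lmean_mono fun x hx => ?_).trans h)
  rw [Real.enorm_of_nonneg (hf x hx)]

theorem lmean_ofReal {p : PMF ι} {f : ι → ℝ} (hf : ∀ x ∈ p.support, 0 ≤ f x) (h : HasMean p f) :
    lmean p (fun x => ENNReal.ofReal (f x)) = ENNReal.ofReal (mean p f) := by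
  unfold mean
  have hn : ∀ x, 0 ≤ (p x).toReal * f x := by
    intro x
    by_cases hx : p x = 0
    · simp [hx]
    · exact mul_nonneg ENNReal.toReal_nonneg (hf x hx)
  rw [ENNReal.ofReal_tsum_of_nonneg hn h.summable]
  refine tsum_congr fun x => ?_
  rw [ENNReal.ofReal_mul ENNReal.toReal_nonneg, ENNReal.ofReal_toReal (p.apply_ne_top x)]

theorem mean_le_of_lmean_le {p : PMF ι} {f : ι → ℝ} (hf : ∀ x ∈ p.support, 0 ≤ f x) {c : ℝ}
    (hc : 0 ≤ c) (h : lmean p (fun x => ENNReal.ofReal (f x)) ≤ ENNReal.ofReal c) :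
    mean p f ≤ c := by
  rw [lmean_ofReal hf (.of_lmean_le hf h)] at h
  exact (ENNReal.ofReal_le_ofReal_iff hc).1 h

theorem HasMean.sqrt {p : PMF ι} {f : ι → ℝ} (hf : ∀ x ∈ p.support, 0 ≤ f x) (h : HasMean p f) :
    HasMean p fun x => √(f x) :=
  .of_sq (h.mono fun x hx => by rw [Real.sq_sqrt (hf x hx), abs_of_nonneg (hf x hx)])

/-- Jensen's inequality for the square root. -/
theorem mean_sqrt_le {p : PMF ι} {f : ι → ℝ} (hf : ∀ x ∈ p.support, 0 ≤ f x) (h : HasMean p f)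
    {b : ℝ} (hb : mean p f ≤ b) : mean p (fun x => √(f x)) ≤ √b := by
  have hm : HasMean p fun x => √(f x) := h.sqrt hf
  -- The variance of √f, which is nonnegative.
  have h2 : mean p (fun x => (√(f x) - mean p fun x => √(f x)) ^ 2)
      = mean p f - (mean p fun x => √(f x)) ^ 2 := by
    set m := mean p fun x => √(f x) with hmdef
    have : mean p (fun x => (√(f x) - m) ^ 2) = mean p fun x => (f x + m ^ 2) - 2 * m * √(f x) :=
      mean_congr fun x hx => by
        nlinarith [Real.sq_sqrt (hf x hx)]
    rw [this, mean_sub (h.add (hasMean_const _ _)) (hm.const_mul _),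
      mean_add h (hasMean_const _ _), mean_const, mean_const_mul, ← hmdef]
    ring
  have h3 : 0 ≤ mean p (fun x => (√(f x) - mean p fun x => √(f x)) ^ 2) :=
    mean_nonneg fun x => sq_nonneg _
  exact Real.le_sqrt_of_sq_le (by linarith)

end Expectation

/-! ### Bellman equation, visitation laws and performance difference -/

section Values

variable {S A : Type*} (M : MDP S A)

theorem pairLaw_bind {τ : Type*} (π : Policy S A) (p : PMF τ) (q : τ → PMF (S × A)) (t : ℕ) :
    pairLaw M π (p.bind q) t = p.bind fun i => pairLaw M π (q i) t := by
  induction t with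
  | zero => rfl
  | succ t ih => simp only [pairLaw, ih, PMF.bind_bind]

/-- The recursion of `pairLaw` peels off the last step; the Bellman equation and the rollouts need
the first one peeled off instead. -/
theorem pairLaw_succ_eq (π : Policy S A) (μ : PMF (S × A)) (t : ℕ) :
    pairLaw M π μ (t + 1) = pairLaw M π (μ.bind (step M π)) t := by
  induction t with
  | zero => rfl
  | succ t ih => rw [pairLaw, ih]; rfl

theorem startLaw_map_fst (π : Policy S A) (ρ : PMF S) : (startLaw π ρ).map Prod.fst = ρ := by
  unfold startLaw
  rw [PMF.map_bind]
  simp_rw [PMF.map_comp]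
  have : ∀ s : S, PMF.map (Prod.fst ∘ fun a : A => (s, a)) (π s) = PMF.pure s :=
    fun s => PMF.map_const (π s) s
  simp_rw [this, PMF.bind_pure]

theorem startLaw_apply (π : Policy S A) (ρ : PMF S) (x : S × A) :
    startLaw π ρ x = ρ x.1 * π x.1 x.2 := by
  classical
  unfold startLaw
  rw [PMF.bind_apply, tsum_eq_single x.1]
  · rw [PMF.map_apply, tsum_eq_single x.2]
    · simp
    · intro a ha
      rw [if_neg]
      exact fun h => ha (congrArg Prod.snd h).symm
  · intro s hs
    rw [PMF.map_apply, ENNReal.tsum_eq_zero.2, mul_zero]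
    intro a
    rw [if_neg]
    exact fun h => hs (congrArg Prod.fst h).symm

theorem pairLaw_eq_startLaw (π : Policy S A) (ρ : PMF S) (t : ℕ) :
    ∃ q : PMF S, pairLaw M π (startLaw π ρ) t = startLaw π q := by
  cases t with
  | zero => exact ⟨ρ, rfl⟩
  | succ t =>
    refine ⟨(pairLaw M π (startLaw π ρ) t).bind fun x => M.P x.1 x.2, ?_⟩
    rw [pairLaw]
    simp only [startLaw, PMF.bind_bind]
    rfl

/-- At every time the action is drawn from π given the state, so the joint law is the state marginal
times π. Thus d⋆ is an ordinary state-action visitation law, and facts about `pairVisit` apply to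
it. -/
theorem comparatorVisit_eq_pairVisit (π : Policy S A) (ρ : PMF S) (x : S × A) :
    comparatorVisit M π ρ x = pairVisit M π (startLaw π ρ) x := by
  unfold comparatorVisit stateVisit pairVisit
  rw [mul_assoc, ← tsum_mul_right]
  congr 1
  refine tsum_congr fun t => ?_
  obtain ⟨q, hq⟩ := pairLaw_eq_startLaw M π ρ t
  rw [hq, startLaw_map_fst, startLaw_apply, ENNReal.toReal_mul, mul_assoc]

theorem summable_discount_mul {c : ℕ → ℝ} {C : ℝ} (h : ∀ t, |c t| ≤ C) :
    Summable fun t => M.γ ^ t * c t := by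
  refine Summable.of_norm_bounded
    ((summable_geometric_of_lt_one M.γ_nonneg M.γ_lt_one).mul_right C) fun t => ?_
  rw [norm_mul, Real.norm_of_nonneg (pow_nonneg M.γ_nonneg t)]
  exact mul_le_mul_of_nonneg_left (h t) (pow_nonneg M.γ_nonneg t)

theorem one_sub_γ_pos : 0 < 1 - M.γ := sub_pos.2 M.γ_lt_one

theorem pmf_toReal_le_one {τ : Type*} (p : PMF τ) (x : τ) : (p x).toReal ≤ 1 :=
  ENNReal.toReal_le_of_le_ofReal zero_le_one (by simpa using p.coe_le_one x)

theorem summable_pairVisit (π : Policy S A) (μ : PMF (S × A)) (x : S × A) :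
    Summable fun t => M.γ ^ t * (pairLaw M π μ t x).toReal :=
  summable_discount_mul M (C := 1) fun t => by
    rw [abs_of_nonneg ENNReal.toReal_nonneg]
    exact pmf_toReal_le_one _ _

theorem pairVisit_nonneg (π : Policy S A) (μ : PMF (S × A)) (x : S × A) :
    0 ≤ pairVisit M π μ x :=
  mul_nonneg (one_sub_γ_pos M).le
    (tsum_nonneg fun t => mul_nonneg (pow_nonneg M.γ_nonneg t) ENNReal.toReal_nonneg)

/-- The time-zero term of the visitation series. It lets a condition number relative to ν act on
errors measured under d_ν. -/
theorem one_sub_γ_mul_le_pairVisit (π : Policy S A) (μ : PMF (S × A)) (x : S × A) :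
    (1 - M.γ) * (μ x).toReal ≤ pairVisit M π μ x := by
  refine mul_le_mul_of_nonneg_left ?_ (one_sub_γ_pos M).le
  have := (summable_pairVisit M π μ x).le_tsum 0
    fun t _ => mul_nonneg (pow_nonneg M.γ_nonneg t) ENNReal.toReal_nonneg
  simpa [pairLaw] using this

theorem comparatorVisit_nonneg (π : Policy S A) (ρ : PMF S) (x : S × A) :
    0 ≤ comparatorVisit M π ρ x := by
  rw [comparatorVisit_eq_pairVisit]
  exact pairVisit_nonneg M π _ x

theorem discountedReward_nonneg (π : Policy S A) (μ : PMF (S × A)) :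
    0 ≤ discountedReward M π μ :=
  tsum_nonneg fun t => mul_nonneg (pow_nonneg M.γ_nonneg t)
    (mean_nonneg fun x => M.r_nonneg x.1 x.2)

variable [Fintype S] [Fintype A]

theorem exists_abs_mean_le (f : S × A → ℝ) : ∃ C, ∀ p : PMF (S × A), |mean p f| ≤ C := by
  obtain ⟨C, hC⟩ := (Set.finite_range fun x => |f x|).bddAbove
  have hC' : ∀ x, |f x| ≤ C := fun x => hC ⟨x, rfl⟩
  refine ⟨C, fun p => abs_le.2 ⟨?_, ?_⟩⟩
  · exact le_mean_of_le (.of_finite _ _) fun x _ => (abs_le.1 (hC' x)).1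
  · exact mean_le_of_le (.of_finite _ _) fun x _ => (abs_le.1 (hC' x)).2

theorem summable_discount_mean (π : Policy S A) (μ : PMF (S × A)) (f : S × A → ℝ) :
    Summable fun t => M.γ ^ t * mean (pairLaw M π μ t) f := by
  obtain ⟨C, hC⟩ := exists_abs_mean_le f
  exact summable_discount_mul M fun t => hC _

theorem sum_pairVisit_mul (π : Policy S A) (μ : PMF (S × A)) (f : S × A → ℝ) :
    ∑ x, pairVisit M π μ x * f x = (1 - M.γ) * ∑' t, M.γ ^ t * mean (pairLaw M π μ t) f := by
  simp_rw [mean_eq_sum, pairVisit, mul_assoc, ← Finset.mul_sum]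
  congr 1
  simp_rw [Finset.mul_sum]
  rw [Summable.tsum_finsetSum]
  · refine Finset.sum_congr rfl fun x _ => ?_
    rw [← tsum_mul_right]
    simp_rw [mul_assoc]
  · intro x _
    simpa [mul_assoc] using (summable_pairVisit M π μ x).mul_right (f x)

theorem sum_pairVisit (π : Policy S A) (μ : PMF (S × A)) : ∑ x, pairVisit M π μ x = 1 := by
  have := sum_pairVisit_mul M π μ fun _ => 1
  simp only [mul_one, mean_const] at this
  rw [this, tsum_geometric_of_lt_one M.γ_nonneg M.γ_lt_one,
    mul_inv_cancel₀ (one_sub_γ_pos M).ne']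

theorem discountedReward_bind {τ : Type*} [Finite τ] (π : Policy S A) (p : PMF τ)
    (q : τ → PMF (S × A)) :
    discountedReward M π (p.bind q) = mean p fun i => discountedReward M π (q i) := by
  have := Fintype.ofFinite τ
  unfold discountedReward
  simp_rw [pairLaw_bind, mean_bind (HasMean.of_finite _ _), mean_eq_sum p, Finset.mul_sum]
  rw [Summable.tsum_finsetSum]
  · refine Finset.sum_congr rfl fun i _ => ?_
    rw [← tsum_mul_left]
    exact tsum_congr fun t => mul_left_comm _ _ _
  · intro i _
    have := (summable_discount_mean M π (q i) fun x => M.r x.1 x.2).mul_left (p i).toReal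
    exact this.congr fun t => mul_left_comm _ _ _

theorem discountedReward_eq_mean_Q (π : Policy S A) (μ : PMF (S × A)) :
    discountedReward M π μ = mean μ fun x => Q M π x.1 x.2 := by
  conv_lhs => rw [← PMF.bind_pure μ]
  exact discountedReward_bind M π μ PMF.pure

theorem mean_startLaw (π : Policy S A) (ρ : PMF S) (f : S × A → ℝ) :
    mean (startLaw π ρ) f = mean ρ fun s => mean (π s) fun a => f (s, a) := by
  unfold startLaw
  rw [mean_bind (.of_finite _ _)]
  simp_rw [mean_map (HasMean.of_finite (_ : PMF A) _)]

theorem V_eq_mean_Q (π : Policy S A) (s : S) : V M π s = mean (π s) fun a => Q M π s a := by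
  rw [V, discountedReward_eq_mean_Q, mean_startLaw, mean_pure]

theorem value_eq_discountedReward (π : Policy S A) (ρ : PMF S) :
    value M π ρ = discountedReward M π (startLaw π ρ) := by
  rw [discountedReward_eq_mean_Q, mean_startLaw, value]
  exact congrArg (mean ρ) (funext (V_eq_mean_Q M π))

theorem mean_step (π : Policy S A) (x : S × A) (f : S × A → ℝ) :
    mean (step M π x) f = mean (M.P x.1 x.2) fun s => mean (π s) fun a => f (s, a) :=
  mean_startLaw π (M.P x.1 x.2) f

/-- The Bellman equation. -/
theorem Q_eq (π : Policy S A) (x : S × A) :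
    Q M π x.1 x.2 = M.r x.1 x.2 + M.γ * mean (M.P x.1 x.2) (V M π) := by
  have h : discountedReward M π (step M π x) = mean (M.P x.1 x.2) (V M π) := by
    rw [discountedReward_eq_mean_Q, mean_step]
    exact congrArg (mean _) (funext fun s => (V_eq_mean_Q M π s).symm)
  rw [← h, Q, discountedReward, (summable_discount_mean M π _ _).tsum_eq_zero_add,
    discountedReward, ← tsum_mul_left]
  congr 1
  · simp [pairLaw, mean_pure]
  · refine tsum_congr fun t => ?_
    rw [pairLaw_succ_eq, PMF.pure_bind, pow_succ']
    ring

theorem discountedReward_le (π : Policy S A) (μ : PMF (S × A)) :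
    discountedReward M π μ ≤ 1 / (1 - M.γ) := by
  rw [one_div, ← tsum_geometric_of_lt_one M.γ_nonneg M.γ_lt_one]
  refine Summable.tsum_le_tsum (fun t => ?_) (summable_discount_mean M π μ _)
    (summable_geometric_of_lt_one M.γ_nonneg M.γ_lt_one)
  exact mul_le_of_le_one_right (pow_nonneg M.γ_nonneg t)
    (mean_le_of_le (.of_finite _ _) fun x _ => M.r_le_one x.1 x.2)

theorem abs_adv_le (π : Policy S A) (s : S) (a : A) : |adv M π s a| ≤ 1 / (1 - M.γ) := by
  rw [adv, Q, V, abs_le]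
  have h1 := discountedReward_nonneg M π (PMF.pure (s, a))
  have h2 := discountedReward_le M π (PMF.pure (s, a))
  have h3 := discountedReward_nonneg M π (startLaw π (PMF.pure s))
  have h4 := discountedReward_le M π (startLaw π (PMF.pure s))
  constructor <;> linarith

theorem value_nonneg (π : Policy S A) (ρ : PMF S) : 0 ≤ value M π ρ := by
  rw [value_eq_discountedReward]
  exact discountedReward_nonneg M π _

theorem value_le (π : Policy S A) (ρ : PMF S) : value M π ρ ≤ 1 / (1 - M.γ) := by
  rw [value_eq_discountedReward]
  exact discountedReward_le M π _

/-- The performance difference lemma. -/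
theorem performance_difference (πstar π : Policy S A) (ρ : PMF S) :
    ∑ x, comparatorVisit M πstar ρ x * adv M π x.1 x.2
      = (1 - M.γ) * (value M πstar ρ - value M π ρ) := by
  simp_rw [comparatorVisit_eq_pairVisit]
  rw [sum_pairVisit_mul]
  congr 1
  set μ := startLaw πstar ρ with hμ
  set v : ℕ → ℝ := fun t => mean (pairLaw M πstar μ t) fun x => V M π x.1 with hv
  -- By the Bellman equation the advantage is the reward plus γV at the next state minus V at the
  -- current one; weighted by γ^t, the value terms telescope to -v 0.
  have hstep : ∀ t, mean (pairLaw M πstar μ t) (fun x => adv M π x.1 x.2)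
      = mean (pairLaw M πstar μ t) (fun x => M.r x.1 x.2) + (M.γ * v (t + 1) - v t) := by
    intro t
    have h1 : v (t + 1) = mean (pairLaw M πstar μ t) fun x => mean (M.P x.1 x.2) (V M π) := by
      simp only [hv, pairLaw]
      rw [mean_bind (.of_finite _ _)]
      simp_rw [mean_step, mean_const]
    rw [h1, ← mean_const_mul, ← mean_sub (.of_finite _ _) (.of_finite _ _),
      ← mean_add (.of_finite _ _) (.of_finite _ _)]
    refine mean_congr fun x _ => ?_
    rw [adv, Q_eq]
    ring
  have hs : Summable fun t => M.γ ^ t * v t := summable_discount_mean M πstar μ _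
  have hs1 : Summable fun t => M.γ ^ (t + 1) * v (t + 1) := (summable_nat_add_iff 1).2 hs
  calc ∑' t, M.γ ^ t * mean (pairLaw M πstar μ t) (fun x => adv M π x.1 x.2)
      = ∑' t, (M.γ ^ t * mean (pairLaw M πstar μ t) (fun x => M.r x.1 x.2)
          + (M.γ ^ (t + 1) * v (t + 1) - M.γ ^ t * v t)) := by
        refine tsum_congr fun t => ?_
        rw [hstep, pow_succ]
        ring
    _ = discountedReward M πstar μ + (∑' t, M.γ ^ (t + 1) * v (t + 1) - ∑' t, M.γ ^ t * v t) := by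
        rw [(summable_discount_mean M πstar μ _).tsum_add (hs1.sub hs), hs1.tsum_sub hs]
        rfl
    _ = value M πstar ρ - value M π ρ := by
        rw [hs.tsum_eq_zero_add, ← value_eq_discountedReward]
        have : v 0 = value M π ρ := by
          simp only [hv, pairLaw, hμ]
          rw [mean_startLaw, value]
          simp_rw [mean_const]
        rw [this]
        ring

end Values

/-! ### Moments of the geometric number of rounds -/

section Loops

variable {α : Type*} {γ : ℝ} (h0 : 0 ≤ γ) (h1 : γ < 1)

theorem roundsLaw_apply (n : ℕ) : roundsLaw γ h0 h1 n = ENNReal.ofReal ((1 - γ) * γ ^ n) := rfl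

theorem toReal_roundsLaw (n : ℕ) : (roundsLaw γ h0 h1 n).toReal = (1 - γ) * γ ^ n :=
  ENNReal.toReal_ofReal (mul_nonneg (by linarith) (pow_nonneg h0 n))

theorem lmean_roundsLaw {f : ℕ → ℝ} (hf : ∀ n, 0 ≤ f n) {c : ℝ}
    (h : HasSum (fun n => γ ^ n * f n) c) :
    lmean (roundsLaw γ h0 h1) (fun n => ENNReal.ofReal (f n)) = ENNReal.ofReal ((1 - γ) * c) := by
  unfold lmean
  have hn : ∀ n, 0 ≤ (1 - γ) * γ ^ n := fun n => mul_nonneg (by linarith) (pow_nonneg h0 n)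
  have hs : HasSum (fun n => (1 - γ) * γ ^ n * f n) ((1 - γ) * c) := by
    simpa [mul_assoc] using h.mul_left (1 - γ)
  rw [← hs.tsum_eq, ENNReal.ofReal_tsum_of_nonneg (fun n => mul_nonneg (hn n) (hf n)) hs.summable]
  refine tsum_congr fun n => ?_
  rw [roundsLaw_apply, ← ENNReal.ofReal_mul (hn n)]

theorem lmean_roundsLaw_succ :
    lmean (roundsLaw γ h0 h1) (fun n => ENNReal.ofReal (n + 1)) = ENNReal.ofReal (1 / (1 - γ)) := by
  have h := hasSum_choose_mul_geometric_of_norm_lt_one (𝕜 := ℝ) 1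
    (r := γ) (by rwa [Real.norm_of_nonneg h0])
  have h' : HasSum (fun n : ℕ => γ ^ n * ((n : ℝ) + 1)) (1 / (1 - γ) ^ 2) := by
    refine (congrArg (HasSum · _) (funext fun n => ?_)).mp h
    rw [Nat.choose_one_right]
    push_cast
    ring
  rw [lmean_roundsLaw h0 h1 (fun n => by positivity) h']
  congr 1
  have : 1 - γ ≠ 0 := by linarith
  field_simp

/-- Bound (n+1)² by (n+2)(n+1), twice a binomial coefficient, whose geometric series is explicit. -/
theorem lmean_roundsLaw_sq_le :
    lmean (roundsLaw γ h0 h1) (fun n => ENNReal.ofReal (((n : ℝ) + 1) ^ 2))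
      ≤ ENNReal.ofReal (2 / (1 - γ) ^ 2) := by
  have h := hasSum_choose_mul_geometric_of_norm_lt_one (𝕜 := ℝ) 2
    (r := γ) (by rwa [Real.norm_of_nonneg h0])
  have h' : HasSum (fun n : ℕ => γ ^ n * (((n : ℝ) + 2) * (n + 1))) (2 * (1 / (1 - γ) ^ 3)) := by
    refine (congrArg (HasSum · _) (funext fun n => ?_)).mp (h.mul_left 2)
    rw [Nat.cast_choose_two]
    push_cast
    ring
  calc _ ≤ lmean (roundsLaw γ h0 h1) (fun n => ENNReal.ofReal (((n : ℝ) + 2) * (n + 1))) :=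
        lmean_mono fun n _ => ENNReal.ofReal_le_ofReal (by nlinarith [Nat.cast_nonneg (α := ℝ) n])
    _ = _ := by
      rw [lmean_roundsLaw h0 h1 (fun n => by positivity) h']
      congr 1
      have : 1 - γ ≠ 0 := by linarith
      field_simp

/-- The coins are independent of the path, so the number of rounds may be drawn before anything
else. -/
theorem bind_coinLoop {τ : Type*} (p : PMF τ) (f : τ → α) (body : α → PMF α) :
    (p.bind fun i => coinLoop γ h0 h1 body (f i))
      = (roundsLaw γ h0 h1).bind fun n => p.bind fun i => iterBody body n (f i) := by
  unfold coinLoop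
  rw [PMF.bind_comm]

end Loops

/-! ### The sampler: law of the accepted pair, unbiasedness, second moment, length -/

section Sampler

variable {S A : Type*} (M : MDP S A) (π : Policy S A)

theorem mem_support_execute {z z' : Rollout S A} (h : z' ∈ (execute M π z).support) :
    z'.samples = z.samples + 1 ∧ z'.ret = z.ret + M.r z.pair.1 z.pair.2 := by
  rw [execute, PMF.support_map] at h
  obtain ⟨x, -, rfl⟩ := h
  exact ⟨rfl, rfl⟩

theorem mem_support_iterBody_execute (n : ℕ) {z z' : Rollout S A}
    (h : z' ∈ (iterBody (execute M π) n z).support) :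
    z'.samples = z.samples + n ∧ z.ret ≤ z'.ret ∧ z'.ret ≤ z.ret + n := by
  induction n generalizing z with
  | zero =>
    rw [iterBody, PMF.support_pure] at h
    obtain rfl : z' = z := h
    simp
  | succ n ih =>
    rw [iterBody, PMF.mem_support_bind_iff] at h
    obtain ⟨y, hy, hz⟩ := h
    obtain ⟨h1, h2⟩ := mem_support_execute M π hy
    obtain ⟨h3, h4, h5⟩ := ih hz
    have := M.r_nonneg z.pair.1 z.pair.2
    have := M.r_le_one z.pair.1 z.pair.2
    push_cast
    exact ⟨by omega, by linarith, by linarith⟩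

theorem hasMean_iterBody_execute (n : ℕ) (z : Rollout S A) :
    HasMean (iterBody (execute M π) n z) Rollout.ret := by
  refine .of_bounded (c := |z.ret| + n) fun z' hz' => ?_
  obtain ⟨-, h1, h2⟩ := mem_support_iterBody_execute M π n hz'
  have := neg_abs_le z.ret
  have := le_abs_self z.ret
  have : (0 : ℝ) ≤ n := n.cast_nonneg
  exact abs_le.2 ⟨by linarith, by linarith⟩

/-- The index is n + 1 because one action is executed before the first coin is tossed. -/
theorem rollout_eq (x : S × A) (k : ℕ) :
    rollout M π x k = (roundsLaw M.γ M.γ_nonneg M.γ_lt_one).bind fun n =>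
      iterBody (execute M π) (n + 1) ⟨x, 0, k⟩ :=
  bind_coinLoop M.γ_nonneg M.γ_lt_one _ (fun z => z) _

theorem lmean_rollout_ret_sq_le (x : S × A) (k : ℕ) :
    lmean (rollout M π x k) (fun z => ENNReal.ofReal (z.ret ^ 2))
      ≤ ENNReal.ofReal (2 / (1 - M.γ) ^ 2) := by
  rw [rollout_eq, lmean_bind]
  refine (lmean_mono fun n _ => ?_).trans (lmean_roundsLaw_sq_le M.γ_nonneg M.γ_lt_one)
  refine (lmean_mono (g := fun _ => ENNReal.ofReal (((n : ℝ) + 1) ^ 2)) fun z hz => ?_).trans_eq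
    (lmean_const _ _)
  obtain ⟨-, h1, h2⟩ := mem_support_iterBody_execute M π _ hz
  push_cast at h2
  dsimp only at h1 h2
  exact ENNReal.ofReal_le_ofReal (pow_le_pow_left₀ h1 (by linarith) 2)

theorem lmean_rollout_samples (x : S × A) (k : ℕ) :
    lmean (rollout M π x k) (fun z => (z.samples : ℝ≥0∞))
      = k + ENNReal.ofReal (1 / (1 - M.γ)) := by
  rw [rollout_eq, lmean_bind, ← lmean_roundsLaw_succ M.γ_nonneg M.γ_lt_one,
    ← lmean_const (roundsLaw M.γ M.γ_nonneg M.γ_lt_one) (k : ℝ≥0∞), ← lmean_add]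
  refine lmean_congr fun n _ => ?_
  rw [← lmean_const (iterBody (execute M π) (n + 1) ⟨x, 0, k⟩)
    ((k : ℝ≥0∞) + ENNReal.ofReal (n + 1))]
  refine lmean_congr fun z hz => ?_
  rw [(mem_support_iterBody_execute M π _ hz).1]
  dsimp only
  rw [show (n : ℝ) + 1 = ((n + 1 : ℕ) : ℝ) by push_cast; rfl, ENNReal.ofReal_natCast]
  push_cast
  rfl

theorem hasMean_rollout_ret_sq (x : S × A) (k : ℕ) :
    HasMean (rollout M π x k) fun z => z.ret ^ 2 :=
  .of_lmean_le (fun _ _ => sq_nonneg _) (lmean_rollout_ret_sq_le M π x k)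

theorem hasMean_rollout_ret (x : S × A) (k : ℕ) : HasMean (rollout M π x k) Rollout.ret :=
  .of_sq (hasMean_rollout_ret_sq M π x k)

/-- The walk `(s_h, a_h)`, with the number of samples so far, that produces the accepted pair. -/
noncomputable def acceptBody (z : (S × A) × ℕ) : PMF ((S × A) × ℕ) :=
  (step M π z.1).map fun x => (x, z.2 + 1)

/-- The law of the accepted pair and of the number of samples spent on it. -/
noncomputable def acceptLaw (ν : PMF (S × A)) : PMF ((S × A) × ℕ) :=
  ν.bind fun x => coinLoop M.γ M.γ_nonneg M.γ_lt_one (acceptBody M π) (x, 1)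

/-- The second phase of the sampler, started at an accepted pair. -/
noncomputable def estimateLaw (z : (S × A) × ℕ) : PMF (Draw S A) :=
  fairCoin.bind fun sampleQ =>
  if sampleQ then
    (rollout M π z.1 z.2).map fun o => ⟨z.1, 2 * (o.ret - 0), o.samples⟩
  else
    (π z.1.1).bind fun a' =>
    (rollout M π (z.1.1, a') z.2).map fun o => ⟨z.1, 2 * (0 - o.ret), o.samples⟩

theorem sampler_eq (ν : PMF (S × A)) :
    sampler M π ν = (acceptLaw M π ν).bind (estimateLaw M π) := by
  unfold acceptLaw
  rw [PMF.bind_bind]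
  rfl

theorem acceptLaw_eq (ν : PMF (S × A)) :
    acceptLaw M π ν = (roundsLaw M.γ M.γ_nonneg M.γ_lt_one).bind fun n =>
      ν.bind fun x => iterBody (acceptBody M π) n (x, 1) :=
  bind_coinLoop M.γ_nonneg M.γ_lt_one ν (fun x => (x, 1)) _

/-- The sample counter is deterministic given the number of rounds, so the walk is `pairLaw` with a
label attached. Stopping it at a geometric time then yields exactly the weights (1-γ)γ^n of d_ν. -/
theorem iterBody_acceptBody (n : ℕ) (x : S × A) (k : ℕ) :
    iterBody (acceptBody M π) n (x, k)
      = (pairLaw M π (PMF.pure x) n).map fun y => (y, k + n) := by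
  induction n generalizing x k with
  | zero => simp [iterBody, pairLaw, PMF.pure_map]
  | succ n ih =>
    rw [iterBody, acceptBody, PMF.bind_map, pairLaw_succ_eq, PMF.pure_bind]
    conv_rhs => rw [← PMF.bind_pure (step M π x), pairLaw_bind, PMF.map_bind]
    congr 1
    funext y
    rw [Function.comp_apply, ih]
    simp only [add_assoc, add_comm 1 n]

theorem acceptLaw_eq_map (ν : PMF (S × A)) :
    acceptLaw M π ν = (roundsLaw M.γ M.γ_nonneg M.γ_lt_one).bind fun n =>
      (pairLaw M π ν n).map fun y => (y, 1 + n) := by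
  rw [acceptLaw_eq]
  simp_rw [iterBody_acceptBody, ← PMF.map_bind, ← pairLaw_bind, PMF.bind_pure]

theorem lmean_acceptLaw_samples (ν : PMF (S × A)) :
    lmean (acceptLaw M π ν) (fun z => (z.2 : ℝ≥0∞)) = ENNReal.ofReal (1 / (1 - M.γ)) := by
  rw [acceptLaw_eq_map, lmean_bind, ← lmean_roundsLaw_succ M.γ_nonneg M.γ_lt_one]
  simp_rw [lmean_map, lmean_const]
  refine lmean_congr fun n _ => ?_
  rw [show (n : ℝ) + 1 = ((1 + n : ℕ) : ℝ) by push_cast; ring, ENNReal.ofReal_natCast]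

theorem mean_fairCoin (f : Bool → ℝ) : mean fairCoin f = (f true + f false) / 2 := by
  rw [mean_eq_sum, Fintype.sum_bool]
  simp [fairCoin, PMF.uniformOfFintype_apply]
  ring

theorem lmean_fairCoin (f : Bool → ℝ≥0∞) : lmean fairCoin f = 2⁻¹ * (f true + f false) := by
  unfold lmean
  rw [tsum_fintype, Fintype.sum_bool]
  simp [fairCoin, PMF.uniformOfFintype_apply, mul_add]

theorem lmean_estimateLaw_samples (z : (S × A) × ℕ) :
    lmean (estimateLaw M π z) (fun o => (o.samples : ℝ≥0∞))
      = z.2 + ENNReal.ofReal (1 / (1 - M.γ)) := by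
  rw [estimateLaw, lmean_bind, lmean_fairCoin]
  simp only [if_true, Bool.false_eq_true, if_false, lmean_bind, lmean_map, lmean_rollout_samples,
    lmean_const]
  rw [← two_mul, ← mul_assoc, ENNReal.inv_mul_cancel two_ne_zero ENNReal.ofNat_ne_top, one_mul]

/-- The expected length of an episode of the sampler. -/
theorem lmean_sampler_samples (ν : PMF (S × A)) :
    lmean (sampler M π ν) (fun o => (o.samples : ℝ≥0∞)) = ENNReal.ofReal (2 / (1 - M.γ)) := by
  have h := one_sub_γ_pos M
  rw [sampler_eq, lmean_bind]
  simp_rw [lmean_estimateLaw_samples]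
  rw [lmean_add, lmean_const, lmean_acceptLaw_samples, ← ENNReal.ofReal_add (by positivity)
    (by positivity)]
  congr 1
  ring

theorem mem_support_estimateLaw {z : (S × A) × ℕ} {o : Draw S A}
    (h : o ∈ (estimateLaw M π z).support) : o.pair = z.1 := by
  rw [estimateLaw, PMF.mem_support_bind_iff] at h
  obtain ⟨b, -, h⟩ := h
  cases b
  · simp only [Bool.false_eq_true, if_false, PMF.mem_support_bind_iff, PMF.mem_support_map_iff] at h
    obtain ⟨a, -, y, -, rfl⟩ := h
    rfl
  · simp only [if_true, PMF.mem_support_map_iff] at h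
    obtain ⟨y, -, rfl⟩ := h
    rfl

/-- On either side of the coin the estimate is ±2 times a rollout return, hence 4 · 2/(1-γ)². The
return is at most its number of rewards, since these lie in [0,1]. -/
theorem lmean_estimateLaw_sq_le (z : (S × A) × ℕ) :
    lmean (estimateLaw M π z) (fun o => ENNReal.ofReal (o.advHat ^ 2))
      ≤ ENNReal.ofReal (8 / (1 - M.γ) ^ 2) := by
  have key : ∀ x k, lmean (rollout M π x k) (fun o => ENNReal.ofReal (4 * o.ret ^ 2))
      ≤ ENNReal.ofReal (8 / (1 - M.γ) ^ 2) := by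
    intro x k
    simp_rw [ENNReal.ofReal_mul (zero_le_four (α := ℝ)), lmean_const_mul]
    refine (mul_le_mul_right (lmean_rollout_ret_sq_le M π x k) _).trans_eq ?_
    rw [← ENNReal.ofReal_mul zero_le_four]
    congr 1
    ring
  have e1 : ∀ y : ℝ, (2 * (y - 0)) ^ 2 = 4 * y ^ 2 := fun y => by ring
  have e2 : ∀ y : ℝ, (2 * (0 - y)) ^ 2 = 4 * y ^ 2 := fun y => by ring
  rw [estimateLaw, lmean_bind, lmean_fairCoin]
  simp only [if_true, Bool.false_eq_true, if_false, lmean_bind, lmean_map, e1, e2]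
  have h2 : lmean (π z.1.1) (fun a => lmean (rollout M π (z.1.1, a) z.2)
      fun o => ENNReal.ofReal (4 * o.ret ^ 2)) ≤ ENNReal.ofReal (8 / (1 - M.γ) ^ 2) :=
    (lmean_mono fun a _ => key _ _).trans_eq (lmean_const _ _)
  refine (mul_le_mul_right (add_le_add (key z.1 z.2) h2) _).trans_eq ?_
  rw [← two_mul, ← mul_assoc, ENNReal.inv_mul_cancel two_ne_zero ENNReal.ofNat_ne_top, one_mul]

theorem lmean_sampler_sq_le (ν : PMF (S × A)) :
    lmean (sampler M π ν) (fun o => ENNReal.ofReal (o.advHat ^ 2))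
      ≤ ENNReal.ofReal (8 / (1 - M.γ) ^ 2) := by
  rw [sampler_eq, lmean_bind]
  exact (lmean_mono fun z _ => lmean_estimateLaw_sq_le M π z).trans_eq (lmean_const _ _)

theorem hasMean_sampler_sq (ν : PMF (S × A)) :
    HasMean (sampler M π ν) fun o => o.advHat ^ 2 :=
  .of_lmean_le (fun _ _ => sq_nonneg _) (lmean_sampler_sq_le M π ν)

theorem mean_sampler_sq_le (ν : PMF (S × A)) :
    mean (sampler M π ν) (fun o => o.advHat ^ 2) ≤ 8 / (1 - M.γ) ^ 2 :=
  mean_le_of_lmean_le (fun _ _ => sq_nonneg _) (by positivity) (lmean_sampler_sq_le M π ν)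

variable [Fintype S] [Fintype A]

theorem mean_iterBody_execute (n : ℕ) (z : Rollout S A) :
    mean (iterBody (execute M π) n z) Rollout.ret
      = z.ret + ∑ t ∈ Finset.range n,
          mean (pairLaw M π (PMF.pure z.pair) t) fun x => M.r x.1 x.2 := by
  induction n generalizing z with
  | zero => simp [iterBody, mean_pure]
  | succ n ih =>
    have h := hasMean_iterBody_execute M π (n + 1) z
    rw [iterBody] at h ⊢
    rw [mean_bind h]
    simp_rw [ih]
    rw [execute, mean_map (.of_finite _ _)]
    dsimp only
    rw [mean_add (.of_finite _ _) (.of_finite _ _), mean_const,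
      mean_sum _ fun _ _ => .of_finite _ _, Finset.sum_range_succ', add_assoc]
    congr 1
    rw [add_comm]
    congr 1
    · refine Finset.sum_congr rfl fun t _ => ?_
      rw [pairLaw_succ_eq, PMF.pure_bind]
      conv_rhs => rw [← PMF.bind_pure (step M π z.pair), pairLaw_bind, mean_bind (.of_finite _ _)]
    · simp [pairLaw, mean_pure]

/-- The rollout from `x` is an unbiased estimate of `Q^π(x)`. -/
theorem mean_rollout_ret (x : S × A) (k : ℕ) :
    mean (rollout M π x k) Rollout.ret = Q M π x.1 x.2 := by
  have h := hasMean_rollout_ret M π x k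
  rw [rollout_eq] at h ⊢
  rw [mean_bind h]
  simp_rw [mean_iterBody_execute]
  have hsum := summable_discount_mean M π (PMF.pure x) fun x => M.r x.1 x.2
  have hγ : Summable fun n => M.γ ^ n := summable_geometric_of_lt_one M.γ_nonneg M.γ_lt_one
  -- The mean is a geometrically weighted series of partial sums of expected rewards, that is, the
  -- Cauchy product of the discounted reward series with ∑ γ^n; the factor (1-γ) cancels the latter.
  have hc := tsum_mul_tsum_eq_tsum_sum_range_of_summable_norm hsum.norm hγ.norm
  unfold mean
  simp_rw [toReal_roundsLaw, zero_add, mul_assoc]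
  rw [tsum_mul_left]
  have hQ : Q M π x.1 x.2
      = ∑' t, M.γ ^ t * mean (pairLaw M π (PMF.pure x) t) fun x => M.r x.1 x.2 := rfl
  rw [tsum_geometric_of_lt_one M.γ_nonneg M.γ_lt_one, ← hQ] at hc
  rw [← mul_inv_cancel_right₀ (one_sub_γ_pos M).ne' (Q M π x.1 x.2), mul_right_comm, hc, mul_comm]
  congr 1
  refine tsum_congr fun n => ?_
  rw [Finset.mul_sum]
  refine Finset.sum_congr rfl fun t ht => ?_
  rw [mul_right_comm, ← pow_add, Nat.add_sub_cancel' (Nat.lt_succ_iff.1 (Finset.mem_range.1 ht))]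
  rfl

theorem mean_acceptLaw (ν : PMF (S × A)) (f : S × A → ℝ) :
    mean (acceptLaw M π ν) (fun z => f z.1) = ∑ x, pairVisit M π ν x * f x := by
  obtain ⟨C, hC⟩ := (Set.finite_range fun x => |f x|).bddAbove
  have h : HasMean (acceptLaw M π ν) fun z => f z.1 := .of_bounded fun z _ => hC ⟨z.1, rfl⟩
  rw [acceptLaw_eq_map] at h ⊢
  rw [mean_bind h]
  simp_rw [mean_map (HasMean.of_finite (pairLaw _ _ _ _) _)]
  rw [sum_pairVisit_mul, ← tsum_mul_left]
  refine tsum_congr fun n => ?_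
  rw [toReal_roundsLaw, mul_assoc]

/-- The factor 2 undoes the coin: half of 2Q minus half of 2V, the second because V is the mean of Q
over a fresh action. -/
theorem mean_estimateLaw (z : (S × A) × ℕ) :
    mean (estimateLaw M π z) Draw.advHat = adv M π z.1.1 z.1.2 := by
  have h : HasMean (estimateLaw M π z) Draw.advHat :=
    .of_sq (.of_lmean_le (fun _ _ => sq_nonneg _) (lmean_estimateLaw_sq_le M π z))
  have hQ : ∀ (x : S × A) k (c : ℝ), mean ((rollout M π x k).map fun o =>
      (⟨z.1, c * o.ret, o.samples⟩ : Draw S A)) Draw.advHat = c * Q M π x.1 x.2 := by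
    intro x k c
    refine (mean_map (f := Draw.advHat) ((hasMean_rollout_ret M π x k).const_mul c)).trans ?_
    rw [mean_const_mul]
    exact congrArg _ (mean_rollout_ret M π x k)
  have e1 : ∀ y : ℝ, 2 * (y - 0) = 2 * y := fun y => by ring
  have e2 : ∀ y : ℝ, 2 * (0 - y) = -2 * y := fun y => by ring
  rw [estimateLaw] at h ⊢
  have h1 := h.of_bind (x := false) (by simp [fairCoin])
  rw [mean_bind h, mean_fairCoin]
  simp only [if_true, Bool.false_eq_true, if_false, e1, e2] at h1 ⊢
  rw [mean_bind h1]
  simp_rw [hQ]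
  rw [adv, V_eq_mean_Q, mean_const_mul]
  ring

variable {M π}

/-- A squared distance after a gradient step expands into this shape: quadratic in the estimate,
with coefficients depending on the accepted pair. The coefficients are bounded because there are
finitely many pairs. -/
theorem hasMean_sampler_quadratic (ν : PMF (S × A)) (c₀ c₁ : S × A → ℝ) (K : ℝ) :
    HasMean (sampler M π ν) fun o => c₀ o.pair + c₁ o.pair * o.advHat + K * o.advHat ^ 2 := by
  obtain ⟨C, hC⟩ := (Set.finite_range fun x => |c₀ x|).bddAbove
  obtain ⟨D, hD⟩ := (Set.finite_range fun x => |c₁ x|).bddAbove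
  have h2 := hasMean_sampler_sq M π ν
  have h1 : HasMean (sampler M π ν) Draw.advHat := .of_sq h2
  refine ((HasMean.of_bounded fun z _ => hC ⟨z.pair, rfl⟩).add ?_).add (h2.const_mul K)
  refine (((hasMean_const _ 1).add h2).const_mul D).mono fun o _ => ?_
  have : |c₁ o.pair| ≤ D := hD ⟨o.pair, rfl⟩
  rw [abs_mul]
  refine mul_le_mul this ?_ (abs_nonneg _) ((abs_nonneg _).trans this)
  rw [← sq_abs]
  nlinarith [sq_nonneg (|o.advHat| - 1), abs_nonneg o.advHat]

/-- The accepted pair has law `d_ν^π`, and `advHat` is an unbiased estimate of its advantage with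
second moment at most `8 / (1 - γ) ^ 2`. -/
theorem mean_sampler_quadratic_le (ν : PMF (S × A)) (c₀ c₁ : S × A → ℝ) {K : ℝ} (hK : 0 ≤ K) :
    mean (sampler M π ν) (fun o => c₀ o.pair + c₁ o.pair * o.advHat + K * o.advHat ^ 2)
      ≤ ∑ x, pairVisit M π ν x * (c₀ x + c₁ x * adv M π x.1 x.2) + K * (8 / (1 - M.γ) ^ 2) := by
  have h0 := hasMean_sampler_quadratic (M := M) (π := π) ν c₀ c₁ 0
  simp only [zero_mul, add_zero] at h0
  rw [mean_add h0 ((hasMean_sampler_sq M π ν).const_mul K), mean_const_mul]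
  refine add_le_add (le_of_eq ?_) (mul_le_mul_of_nonneg_left (mean_sampler_sq_le M π ν) hK)
  -- Condition on the accepted pair: the coefficients are then constants and the estimate averages
  -- to the advantage.
  rw [← mean_acceptLaw M π ν]
  rw [sampler_eq] at h0 ⊢
  rw [mean_bind h0]
  refine mean_congr fun z _ => ?_
  have h : HasMean (estimateLaw M π z) Draw.advHat :=
    .of_sq (.of_lmean_le (fun _ _ => sq_nonneg _) (lmean_estimateLaw_sq_le M π z))
  rw [mean_congr (g := fun o => c₀ z.1 + c₁ z.1 * o.advHat) fun o ho => by
    rw [mem_support_estimateLaw M π ho]]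
  rw [mean_add (hasMean_const _ _) (h.const_mul _), mean_const, mean_const_mul, mean_estimateLaw]

end Sampler

/-! ### Projection onto the ball -/

section Projection

variable {d : ℕ} {W : ℝ}

theorem norm_projBall_le (hW : 0 ≤ W) (v : Param d) : ‖projBall W v‖ ≤ W := by
  unfold projBall
  split_ifs with h
  · exact h
  · have hv : 0 < ‖v‖ := hW.trans_lt (not_le.1 h)
    rw [norm_smul, Real.norm_of_nonneg (by positivity), div_mul_cancel₀ _ hv.ne']

/-- When v lies outside the ball, Cauchy–Schwarz bounds the decrease of the squared distance to w
from below by (‖v‖ - W)². -/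
theorem norm_projBall_sub_sq_le (hW : 0 ≤ W) (v : Param d) {w : Param d} (hw : ‖w‖ ≤ W) :
    ‖projBall W v - w‖ ^ 2 ≤ ‖v - w‖ ^ 2 := by
  unfold projBall
  split_ifs with h
  · rfl
  · rw [not_le] at h
    have hv : 0 < ‖v‖ := hW.trans_lt h
    have hi : inner ℝ v w ≤ ‖v‖ * W :=
      (real_inner_le_norm v w).trans (mul_le_mul_of_nonneg_left hw hv.le)
    rw [norm_sub_sq_real, norm_sub_sq_real, norm_smul, Real.norm_of_nonneg (by positivity),
      div_mul_cancel₀ _ hv.ne', real_inner_smul_left]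
    have h1 : 0 ≤ 1 - W / ‖v‖ := sub_nonneg.2 ((div_le_one hv).2 h.le)
    have h2 : (1 - W / ‖v‖) * inner ℝ v w ≤ (1 - W / ‖v‖) * (‖v‖ * W) :=
      mul_le_mul_of_nonneg_left hi h1
    have h3 : (1 - W / ‖v‖) * (‖v‖ * W) = ‖v‖ * W - W ^ 2 := by field_simp
    nlinarith [sq_nonneg (‖v‖ - W)]

end Projection

/-! ### Convexity and quadratic growth of the compatible loss -/

section Loss

variable {S A : Type*} [Fintype S] [Fintype A] {M : MDP S A} {d : ℕ} {pol : Param d → Policy S A}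
  {ν : PMF (S × A)} {W : ℝ} {θ : Param d}

theorem lossA_nonneg {υ : S × A → ℝ} (hυ : ∀ x, 0 ≤ υ x) (w : Param d) :
    0 ≤ lossA M pol w θ υ :=
  Finset.sum_nonneg fun x _ => mul_nonneg (hυ x) (sq_nonneg _)

theorem continuous_lossA (υ : S × A → ℝ) : Continuous fun w => lossA M pol w θ υ := by
  unfold lossA
  fun_prop

theorem lossA_add_smul (υ : S × A → ℝ) (w v : Param d) (u : ℝ) :
    lossA M pol (w - u • v) θ υ = lossA M pol w θ υ
      + u * (∑ x, υ x * (2 * (adv M (pol θ) x.1 x.2 - inner ℝ w (score pol θ x.1 x.2))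
          * inner ℝ v (score pol θ x.1 x.2)))
      + u ^ 2 * ∑ x, υ x * inner ℝ v (score pol θ x.1 x.2) ^ 2 := by
  unfold lossA
  rw [Finset.mul_sum, Finset.mul_sum, ← Finset.sum_add_distrib, ← Finset.sum_add_distrib]
  refine Finset.sum_congr rfl fun x _ => ?_
  rw [inner_sub_left, real_inner_smul_left]
  ring

/-- Quadratic growth of the compatible loss at its minimizer over the ball. -/
theorem IsBestFit.sum_sq_le {w₀ w : Param d} (h : IsBestFit M pol ν W θ w₀) (hw : ‖w‖ ≤ W) :
    ∑ x, pairVisit M (pol θ) ν x * inner ℝ (w₀ - w) (score pol θ x.1 x.2) ^ 2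
      ≤ lossA M pol w θ (pairVisit M (pol θ) ν) - lossA M pol w₀ θ (pairVisit M (pol θ) ν) := by
  have key := lossA_add_smul (M := M) (pol := pol) (θ := θ) (pairVisit M (pol θ) ν) w₀ (w₀ - w)
  set c := ∑ x, pairVisit M (pol θ) ν x * inner ℝ (w₀ - w) (score pol θ x.1 x.2) ^ 2
  set b := ∑ x, pairVisit M (pol θ) ν x *
    (2 * (adv M (pol θ) x.1 x.2 - inner ℝ w₀ (score pol θ x.1 x.2))
          * inner ℝ (w₀ - w) (score pol θ x.1 x.2))
  have hc : 0 ≤ c := Finset.sum_nonneg fun x _ =>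
    mul_nonneg (pairVisit_nonneg M _ ν x) (sq_nonneg _)
  have hu : ∀ u : ℝ, 0 ≤ u → u ≤ 1 → 0 ≤ u * b + u ^ 2 * c := by
    intro u hu0 hu1
    have hn : ‖w₀ - u • (w₀ - w)‖ ≤ W := by
      have e : w₀ - u • (w₀ - w) = (1 - u) • w₀ + u • w := by module
      rw [e]
      refine (norm_add_le _ _).trans ?_
      rw [norm_smul, norm_smul, Real.norm_of_nonneg hu0, Real.norm_of_nonneg (sub_nonneg.2 hu1)]
      nlinarith [h.1]
    have := h.2 _ hn
    rw [key] at this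
    linarith
  -- First-order optimality: b is the derivative of the loss from w₀ towards w. If b were negative,
  -- u = -b/(2(c-b)) would satisfy u·b + u²·c ≤ u·b/2 < 0, contradicting minimality.
  have hb : 0 ≤ b := by
    by_contra hb
    rw [not_le] at hb
    have hcb : 0 < c - b := by linarith
    set u := -b / (2 * (c - b)) with hudef
    have hu0 : 0 < u := div_pos (by linarith) (by linarith)
    have hu1 : u ≤ 1 := (div_le_one (by linarith)).2 (by linarith)
    have h1 := hu u hu0.le hu1
    have h2 : u * (2 * (c - b)) = -b := div_mul_cancel₀ _ (by linarith)
    nlinarith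
  have := key 1
  rw [one_smul, sub_sub_cancel] at this
  linarith

/-- Convexity, in the form of the running-average recursion. The defect is n/(n+1) times the squared
difference of the two predictions. -/
theorem lossA_average_le {υ : S × A → ℝ} (hυ : ∀ x, 0 ≤ υ x) (n : ℕ) (m w : Param d) :
    ((n : ℝ) + 1) * lossA M pol ((1 / ((n : ℝ) + 1)) • ((n : ℝ) • m + w)) θ υ
      ≤ n * lossA M pol m θ υ + lossA M pol w θ υ := by
  unfold lossA
  rw [Finset.mul_sum, Finset.mul_sum, ← Finset.sum_add_distrib]
  refine Finset.sum_le_sum fun x _ => ?_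
  rw [real_inner_smul_left, inner_add_left, real_inner_smul_left]
  generalize inner ℝ m (score pol θ x.1 x.2) = p
  generalize inner ℝ w (score pol θ x.1 x.2) = q
  generalize adv M (pol θ) x.1 x.2 = a
  have hn : (0 : ℝ) ≤ n := n.cast_nonneg
  have e : n * (a - p) ^ 2 + (a - q) ^ 2 - (n + 1) * (a - 1 / ((n : ℝ) + 1) * (n * p + q)) ^ 2
      = n / (n + 1) * (p - q) ^ 2 := by
    field_simp
    ring
  have : 0 ≤ n / ((n : ℝ) + 1) * (p - q) ^ 2 := by positivity
  nlinarith [hυ x]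

end Loss

/-! ### Projected stochastic gradient descent -/

section SGD

variable {S A : Type*} {M : MDP S A} {d : ℕ} {pol : Param d → Policy S A}
  {ν : PMF (S × A)} {W B α : ℝ} {θ : Param d}

theorem norm_sgdUpdate_le (hW : 0 ≤ W) (w : Param d) (o : Draw S A) :
    ‖sgdUpdate pol W α θ w o‖ ≤ W := norm_projBall_le hW _

theorem mem_support_sgdLoop (hW : 0 ≤ W) (n : ℕ) {z : SGDState d}
    (hz : z ∈ (sgdLoop M pol ν W α θ n).support) : ‖z.cur‖ ≤ W ∧ ‖z.sum‖ ≤ n * W := by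
  induction n generalizing z with
  | zero =>
    rw [sgdLoop, PMF.support_pure] at hz
    obtain rfl : z = _ := hz
    simpa using hW
  | succ n ih =>
    rw [sgdLoop, PMF.mem_support_bind_iff] at hz
    obtain ⟨y, hy, hz⟩ := hz
    rw [PMF.mem_support_map_iff] at hz
    obtain ⟨o, -, rfl⟩ := hz
    have h := norm_sgdUpdate_le (pol := pol) (α := α) (θ := θ) hW y.cur o
    refine ⟨h, (norm_add_le _ _).trans ?_⟩
    push_cast
    linarith [(ih hy).2]

/-- Projection confines the iterate and the running sum to compact balls, on which a continuous
function is bounded. This settles integrability although the advantage estimates are unbounded. -/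
theorem hasMean_sgdLoop (hW : 0 ≤ W) (n : ℕ) {f : Param d × Param d → ℝ} (hf : Continuous f) :
    HasMean (sgdLoop M pol ν W α θ n) fun z => f (z.cur, z.sum) := by
  obtain ⟨C, hC⟩ := ((isCompact_closedBall (0 : Param d) W).prod
    (isCompact_closedBall (0 : Param d) (n * W))).exists_bound_of_continuousOn hf.continuousOn
  refine .of_bounded (c := C) fun z hz => hC _ ?_
  simpa using mem_support_sgdLoop hW n hz

theorem hasMean_sgdUpdate (hW : 0 ≤ W) {f : Param d × Param d → ℝ} (hf : Continuous f)
    (w v : Param d) :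
    HasMean (sampler M (pol θ) ν)
      fun o => f (sgdUpdate pol W α θ w o, v + sgdUpdate pol W α θ w o) := by
  obtain ⟨C, hC⟩ := (isCompact_closedBall (0 : Param d) W).exists_bound_of_continuousOn
    (f := fun u => f (u, v + u)) (by fun_prop)
  refine .of_bounded (c := C) fun o _ => hC _ ?_
  simpa using norm_sgdUpdate_le hW w o

theorem mean_sgdLoop_succ (hW : 0 ≤ W) (n : ℕ) {f : Param d × Param d → ℝ} (hf : Continuous f) :
    HasMean (sgdLoop M pol ν W α θ n) (fun z => mean (sampler M (pol θ) ν)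
      fun o => f (sgdUpdate pol W α θ z.cur o, z.sum + sgdUpdate pol W α θ z.cur o)) ∧
    mean (sgdLoop M pol ν W α θ (n + 1)) (fun z => f (z.cur, z.sum))
      = mean (sgdLoop M pol ν W α θ n) fun z => mean (sampler M (pol θ) ν)
        fun o => f (sgdUpdate pol W α θ z.cur o, z.sum + sgdUpdate pol W α θ z.cur o) := by
  have hm := hasMean_sgdLoop (M := M) (pol := pol) (ν := ν) (α := α) (θ := θ) hW (n + 1) hf
  have e : ∀ z : SGDState d, mean ((sampler M (pol θ) ν).map fun o =>
        (⟨sgdUpdate pol W α θ z.cur o, z.sum + sgdUpdate pol W α θ z.cur o,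
          z.samples + o.samples⟩ : SGDState d)) (fun z => f (z.cur, z.sum))
      = mean (sampler M (pol θ) ν)
        fun o => f (sgdUpdate pol W α θ z.cur o, z.sum + sgdUpdate pol W α θ z.cur o) :=
    fun z => mean_map (f := fun z : SGDState d => f (z.cur, z.sum)) (hasMean_sgdUpdate hW hf _ _)
  rw [sgdLoop] at hm ⊢
  rw [mean_bind hm]
  have hb := hm.bind_mean
  simp only [e] at hb ⊢
  exact ⟨hb, trivial⟩

theorem lmean_sgdLoop_samples (n : ℕ) :
    lmean (sgdLoop M pol ν W α θ n) (fun z => (z.samples : ℝ≥0∞))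
      = n * ENNReal.ofReal (2 / (1 - M.γ)) := by
  induction n with
  | zero => simp [sgdLoop, lmean_pure]
  | succ n ih =>
    rw [sgdLoop, lmean_bind]
    simp only [lmean_map, Nat.cast_add, lmean_add, lmean_const, lmean_sampler_samples, ih]
    push_cast
    ring

variable [Fintype S] [Fintype A]

/-- One projected stochastic gradient step, in expectation. -/
theorem mean_norm_sgdUpdate_sub_sq_le (hW : 0 ≤ W) (hB : 0 ≤ B)
    (hg : ∀ s a, ‖score pol θ s a‖ ≤ B) (hα : 0 ≤ α) {w w₀ : Param d} (hw : ‖w‖ ≤ W)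
    (hw₀ : ‖w₀‖ ≤ W) :
    HasMean (sampler M (pol θ) ν) (fun o => ‖sgdUpdate pol W α θ w o - w₀‖ ^ 2) ∧
    mean (sampler M (pol θ) ν) (fun o => ‖sgdUpdate pol W α θ w o - w₀‖ ^ 2)
      ≤ ‖w - w₀‖ ^ 2 - 2 * α * (lossA M pol w θ (pairVisit M (pol θ) ν)
          - lossA M pol w₀ θ (pairVisit M (pol θ) ν))
        + α ^ 2 * (32 * (B * (B * W + 1) / (1 - M.γ)) ^ 2) := by
  set a : S × A → ℝ := fun x => inner ℝ w (score pol θ x.1 x.2) with ha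
  set a₀ : S × A → ℝ := fun x => inner ℝ w₀ (score pol θ x.1 x.2) with ha₀
  set D := ‖w - w₀‖ ^ 2 with hD
  set K := 4 * α ^ 2 * B ^ 2 with hK
  set e := 1 / (1 - M.γ) with he
  have he1 : 1 ≤ e := by
    rw [he, le_div_iff₀ (one_sub_γ_pos M)]
    linarith [M.γ_nonneg]
  have hK0 : 0 ≤ K := by positivity
  -- Coefficients, in powers of the estimate, of the expanded squared distance after the unprojected
  -- step, with ‖g‖² replaced by B².
  let c₀ : S × A → ℝ := fun x => D - 4 * α * a x * (a x - a₀ x) + K * a x ^ 2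
  let c₁ : S × A → ℝ := fun x => 4 * α * (a x - a₀ x) - 2 * K * a x
  have hpt : ∀ o : Draw S A, ‖sgdUpdate pol W α θ w o - w₀‖ ^ 2
      ≤ c₀ o.pair + c₁ o.pair * o.advHat + K * o.advHat ^ 2 := by
    intro o
    refine (norm_projBall_sub_sq_le hW _ hw₀).trans ?_
    set g := score pol θ o.pair.1 o.pair.2 with hgdef
    rw [sub_right_comm, norm_sub_sq_real, real_inner_smul_right, inner_sub_left, norm_smul, mul_pow,
      Real.norm_eq_abs, sq_abs, ← hD]
    have h1 : inner ℝ w g = a o.pair := rfl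
    have h2 : inner ℝ w₀ g = a₀ o.pair := rfl
    rw [h1, h2]
    have h3 : ‖g‖ ^ 2 ≤ B ^ 2 := pow_le_pow_left₀ (norm_nonneg _) (hg _ _) 2
    have h4 := mul_le_mul_of_nonneg_left h3 (sq_nonneg (2 * α * (a o.pair - o.advHat)))
    refine (add_le_add_right h4 _).trans_eq ?_
    simp only [c₀, c₁, hK]
    ring
  have hq := hasMean_sampler_quadratic (M := M) (π := pol θ) ν c₀ c₁ K
  have hm : HasMean (sampler M (pol θ) ν) (fun o => ‖sgdUpdate pol W α θ w o - w₀‖ ^ 2) :=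
    hq.mono fun o _ => by
      rw [abs_of_nonneg (sq_nonneg _)]
      exact hpt o
  refine ⟨hm, (mean_mono hm hq fun o _ => hpt o).trans
    ((mean_sampler_quadratic_le ν c₀ c₁ hK0).trans ?_)⟩
  -- With the estimate replaced by its mean A, the cross term is 4α(a-a₀)(A-a) = 2α((A-a₀)² - (A-a)²
  -- - (a-a₀)²); dropping the last square leaves a difference of losses.
  have hx : ∀ x, c₀ x + c₁ x * adv M (pol θ) x.1 x.2
      ≤ (D + K * (B ^ 2 * W ^ 2 + 2 * (B * W) * e))
        + 2 * α * (adv M (pol θ) x.1 x.2 - a₀ x) ^ 2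
        - 2 * α * (adv M (pol θ) x.1 x.2 - a x) ^ 2 := by
    intro x
    have h1 : |a x| ≤ B * W := by
      refine (abs_real_inner_le_norm _ _).trans ?_
      rw [mul_comm]
      exact mul_le_mul (hg _ _) hw (norm_nonneg _) hB
    have h2 : |adv M (pol θ) x.1 x.2| ≤ e := abs_adv_le M (pol θ) x.1 x.2
    have h3 : a x ^ 2 ≤ B ^ 2 * W ^ 2 := by
      rw [← mul_pow, ← sq_abs (a x)]
      exact pow_le_pow_left₀ (abs_nonneg _) h1 2
    have h4 : -(a x * adv M (pol θ) x.1 x.2) ≤ (B * W) * e := by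
      refine (neg_le_abs _).trans ?_
      rw [abs_mul]
      exact mul_le_mul h1 h2 (abs_nonneg _) (by positivity)
    have h5 : K * (a x ^ 2 - 2 * (a x * adv M (pol θ) x.1 x.2))
        ≤ K * (B ^ 2 * W ^ 2 + 2 * (B * W) * e) :=
      mul_le_mul_of_nonneg_left (by linarith) hK0
    simp only [c₀, c₁]
    nlinarith [mul_nonneg hα (sq_nonneg (a x - a₀ x))]
  set C := D + K * (B ^ 2 * W ^ 2 + 2 * (B * W) * e) with hC
  have hsum : ∑ x, pairVisit M (pol θ) ν x * (c₀ x + c₁ x * adv M (pol θ) x.1 x.2)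
      ≤ C
        + 2 * α * lossA M pol w₀ θ (pairVisit M (pol θ) ν)
        - 2 * α * lossA M pol w θ (pairVisit M (pol θ) ν) := by
    refine (Finset.sum_le_sum fun x _ =>
      mul_le_mul_of_nonneg_left (hx x) (pairVisit_nonneg M _ ν x)).trans_eq ?_
    simp_rw [mul_sub, mul_add]
    rw [Finset.sum_sub_distrib, Finset.sum_add_distrib, ← Finset.sum_mul, sum_pairVisit,
      one_mul]
    unfold lossA
    simp_rw [Finset.mul_sum, mul_left_comm (2 * α)]
    rfl
  -- As e = 1/(1-γ) ≥ 1, all terms can be raised to e²: with y = BW, y² + 2ye + 8e² ≤ 8(y+1)²e².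
  have hfin : K * (B ^ 2 * W ^ 2 + 2 * (B * W) * e) + K * (8 / (1 - M.γ) ^ 2)
      ≤ α ^ 2 * (32 * (B * (B * W + 1) / (1 - M.γ)) ^ 2) := by
    have h8 : 8 / (1 - M.γ) ^ 2 = 8 * e ^ 2 := by rw [he]; field_simp
    have h9 : α ^ 2 * (32 * (B * (B * W + 1) / (1 - M.γ)) ^ 2)
        = K * (8 * (B * W + 1) ^ 2 * e ^ 2) := by rw [he, hK]; field_simp; ring
    rw [h8, h9, ← mul_add]
    refine mul_le_mul_of_nonneg_left ?_ hK0
    have hBW : 0 ≤ B * W := by positivity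
    rw [← mul_pow]
    generalize B * W = y at hBW
    have h10 : e ≤ e ^ 2 := by nlinarith
    have h11 : y ^ 2 ≤ y ^ 2 * e ^ 2 := le_mul_of_one_le_right (sq_nonneg y) (by nlinarith)
    nlinarith [mul_le_mul_of_nonneg_left h10 hBW, mul_nonneg hBW (sq_nonneg e)]
  linarith

/-- The excess compatible loss of the average of the iterates of projected SGD. -/
theorem mean_excess_lossA_le (hW : 0 ≤ W) (hB : 0 ≤ B) (hg : ∀ s a, ‖score pol θ s a‖ ≤ B)
    (hα : 0 < α) {w₀ : Param d} (hw₀ : IsBestFit M pol ν W θ w₀) {N : ℕ} (hN : 0 < N) :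
    mean (sgdLoop M pol ν W α θ N) (fun z =>
        lossA M pol ((1 / (N : ℝ)) • z.sum) θ (pairVisit M (pol θ) ν)
          - lossA M pol w₀ θ (pairVisit M (pol θ) ν))
      ≤ (W ^ 2 + (N + 1) * (α ^ 2 * (32 * (B * (B * W + 1) / (1 - M.γ)) ^ 2))) / (2 * α * N) := by
  set F : Param d → ℝ := fun w => lossA M pol w θ (pairVisit M (pol θ) ν)
    - lossA M pol w₀ θ (pairVisit M (pol θ) ν) with hF
  have hFc : Continuous F := (continuous_lossA _).sub continuous_const
  set G := α ^ 2 * (32 * (B * (B * W + 1) / (1 - M.γ)) ^ 2) with hG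
  have hstep : ∀ w : Param d, ‖w‖ ≤ W → _ := fun w hw =>
    mean_norm_sgdUpdate_sub_sq_le (M := M) (ν := ν) hW hB hg hα.le hw hw₀.1
  have hF0 : ∀ w, ‖w‖ ≤ W → 0 ≤ F w := fun w hw => sub_nonneg.2 (hw₀.2 w hw)
  -- The averaged iterates are w_1, …, w_N, while a step from w_n controls the loss at w_n. The term
  -- -2αF(w_n) postpones the accounting by one step, so that Ψ grows by at most G per step in mean.
  -- The factor n makes the value of 1/0 irrelevant at n = 0.
  let Ψ : ℕ → Param d × Param d → ℝ := fun n p =>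
    ‖p.1 - w₀‖ ^ 2 - 2 * α * F p.1 + 2 * α * n * F ((1 / (n : ℝ)) • p.2)
  have hΨc : ∀ n, Continuous (Ψ n) := fun n => by
    simp only [Ψ]
    fun_prop
  have hmain : ∀ n, mean (sgdLoop M pol ν W α θ n) (fun z => Ψ n (z.cur, z.sum))
      ≤ W ^ 2 + n * G := by
    intro n
    induction n with
    | zero =>
      rw [sgdLoop, mean_pure]
      have h1 := hF0 0 (by simpa using hW)
      have h2 : ‖(0 : Param d) - w₀‖ ^ 2 ≤ W ^ 2 := by
        rw [zero_sub, norm_neg]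
        exact pow_le_pow_left₀ (norm_nonneg _) hw₀.1 2
      simp only [Ψ, Nat.cast_zero, mul_zero, zero_mul, add_zero]
      nlinarith
    | succ n ih =>
      have hm0 := hasMean_sgdLoop (M := M) (pol := pol) (ν := ν) (α := α) (θ := θ) hW n (hΨc n)
      obtain ⟨hm, he⟩ := mean_sgdLoop_succ (M := M) (pol := pol) (ν := ν) (α := α) (θ := θ) hW n
        (hΨc (n + 1))
      rw [he]
      refine (mean_mono hm (hm0.add (hasMean_const _ G)) fun z hz => ?_).trans ?_
      · have hmz := hasMean_sgdUpdate (M := M) (pol := pol) (ν := ν) (α := α) (θ := θ) hW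
          (hΨc (n + 1)) z.cur z.sum
        obtain ⟨hz1, hz2⟩ := mem_support_sgdLoop hW n hz
        obtain ⟨hu1, hu2⟩ := hstep z.cur hz1
        -- At n = 0 the right side is 0 by the convention 1/0 = 0, and so is the empty sum.
        have hsum : z.sum = (n : ℝ) • ((1 / (n : ℝ)) • z.sum) := by
          rcases Nat.eq_zero_or_pos n with rfl | hn
          · simpa using hz2
          · rw [smul_smul, mul_one_div_cancel (by positivity), one_smul]
        refine (mean_mono hmz (hu1.add (hasMean_const _
          (2 * α * n * F ((1 / (n : ℝ)) • z.sum)))) fun o _ => ?_).trans ?_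
        -- Convexity bounds (n+1)F of the new average by nF of the old one plus F of the new
        -- iterate, which the postponed term cancels.
        · have h := lossA_average_le (M := M) (pol := pol) (θ := θ)
            (pairVisit_nonneg M (pol θ) ν) n ((1 / (n : ℝ)) • z.sum)
            (sgdUpdate pol W α θ z.cur o)
          rw [← hsum] at h
          simp only [Ψ, hF]
          push_cast
          nlinarith
        · rw [mean_add hu1 (hasMean_const _ _), mean_const]
          simp only [Ψ]
          linarith
      · rw [mean_add hm0 (hasMean_const _ _), mean_const]
        push_cast
        linarith
  have hN' : (0 : ℝ) < N := Nat.cast_pos.2 hN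
  have hmF : HasMean (sgdLoop M pol ν W α θ N) fun z => F ((1 / (N : ℝ)) • z.sum) :=
    hasMean_sgdLoop hW N (f := fun p => F ((1 / (N : ℝ)) • p.2)) (by fun_prop)
  rw [le_div_iff₀ (by positivity), mul_comm, ← mean_const_mul]
  -- A fictitious further step from w_N has nonnegative mean squared distance, so ‖w_N - w₀‖² -
  -- 2αF(w_N) ≥ -G. This costs the extra G that makes N + 1 out of N.
  have h := mean_mono ((hmF.const_mul (2 * α * N)).sub (hasMean_const _ G))
    (hasMean_sgdLoop hW N (hΨc N)) fun z hz => by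
      obtain ⟨-, hu2⟩ := hstep z.cur (mem_support_sgdLoop hW N hz).1
      have hu0 := (mean_nonneg (p := sampler M (pol θ) ν) fun o =>
        sq_nonneg ‖sgdUpdate pol W α θ z.cur o - w₀‖).trans hu2
      simp only [Ψ, hF] at hu0 ⊢
      linarith
  rw [mean_sub (hmF.const_mul _) (hasMean_const _ _), mean_const] at h
  linarith [hmain N]

/-- The step size of the inner loop. -/
noncomputable def sgdStepSize (γ W B : ℝ) (N : ℕ) : ℝ :=
  if 0 < B ∧ γ < 1 then W * (1 - γ) / (4 * (B * (B * W + 1)) * √(2 * (N + 1))) else 1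

theorem sgdStepSize_pos (γ B : ℝ) (hW : 0 < W) (N : ℕ) : 0 < sgdStepSize γ W B N := by
  unfold sgdStepSize
  split_ifs with h
  · have := h.1
    have := sub_pos.2 h.2
    positivity
  · exact one_pos

/-- The step size minimizes the preceding bound in α, with minimum 4Wck/N for c = B(BW+1)/(1-γ) and
k = √(2(N+1)); then k ≤ 2√N because N ≥ 1. If B = 0 all scores vanish, the loss does not depend on
w, and any step size serves. -/
theorem mean_excess_lossA_sgdStepSize_le (hW : 0 < W) (hB : 0 ≤ B)
    (hg : ∀ s a, ‖score pol θ s a‖ ≤ B) {w₀ : Param d} (hw₀ : IsBestFit M pol ν W θ w₀) {N : ℕ}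
    (hN : 0 < N) :
    mean (sgdLoop M pol ν W (sgdStepSize M.γ W B N) θ N) (fun z =>
        lossA M pol ((1 / (N : ℝ)) • z.sum) θ (pairVisit M (pol θ) ν)
          - lossA M pol w₀ θ (pairVisit M (pol θ) ν))
      ≤ 8 * (B * W * (B * W + 1)) / ((1 - M.γ) * √N) := by
  have hγ := one_sub_γ_pos M
  rcases hB.eq_or_lt with rfl | hB'
  · have h0 : ∀ s a, score pol θ s a = 0 := fun s a => norm_le_zero_iff.1 (hg s a)
    simp only [lossA, h0, inner_zero_right, sub_self, mean_const, zero_mul, mul_zero, zero_div,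
      le_refl]
  refine (mean_excess_lossA_le hW.le hB hg (sgdStepSize_pos _ _ hW N) hw₀ hN).trans ?_
  have hN' : (0 : ℝ) < N := Nat.cast_pos.2 hN
  have hN1 : (1 : ℝ) ≤ N := Nat.one_le_cast.2 hN
  set c := B * (B * W + 1) / (1 - M.γ) with hc
  have hc0 : 0 < c := by positivity
  set k := √(2 * ((N : ℝ) + 1)) with hk
  have hk0 : 0 < k := Real.sqrt_pos.2 (by positivity)
  have hk2 : k ^ 2 = 2 * (N + 1) := Real.sq_sqrt (by positivity)
  have hα : sgdStepSize M.γ W B N = W / (4 * c * k) := by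
    rw [sgdStepSize, if_pos ⟨hB', M.γ_lt_one⟩, hc, ← hk]
    field_simp
  have hs0 : 0 < √(N : ℝ) := Real.sqrt_pos.2 hN'
  have hs2 : √(N : ℝ) ^ 2 = N := Real.sq_sqrt hN'.le
  have hks : k ≤ 2 * √(N : ℝ) := by
    refine abs_le_of_sq_le_sq' ?_ (by positivity) |>.2
    rw [hk2, mul_pow, hs2]
    linarith
  have e1 : (W ^ 2 + (N + 1) * ((W / (4 * c * k)) ^ 2 * (32 * c ^ 2)))
      / (2 * (W / (4 * c * k)) * N) = 4 * W * c * k / N := by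
    have : (N : ℝ) + 1 = k ^ 2 / 2 := by rw [hk2]; ring
    rw [this]
    field_simp
    ring
  have e2 : 8 * (B * W * (B * W + 1)) / ((1 - M.γ) * √N) = 8 * W * c / √N := by
    rw [hc]
    field_simp
  rw [hα, e1, e2, div_le_div_iff₀ hN' hs0]
  nth_rewrite 2 [← hs2]
  nlinarith [mul_le_mul_of_nonneg_left hks (show 0 ≤ 4 * W * c * √(N : ℝ) by positivity)]

end SGD

/-! ### Quadratic lower bound for the log-policy -/

section Smoothness

variable {S A : Type*} {d : ℕ} {pol : Param d → Policy S A} {β : ℝ}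

theorem SmoothPolicy.log_add_ge (h : SmoothPolicy β pol) (θ v : Param d) (s : S) (a : A) :
    Real.log (pol θ s a).toReal + inner ℝ v (score pol θ s a) - β / 2 * ‖v‖ ^ 2
      ≤ Real.log (pol (θ + v) s a).toReal := by
  obtain ⟨-, hd, hL⟩ := h s a
  set f : Param d → ℝ := fun θ' => Real.log (pol θ' s a).toReal with hf
  -- On [0,1] the Lipschitz gradient lets the first part of the derivative fall to -βu‖v‖² at worst,
  -- which the derivative of the added square compensates. So g is monotone, and g 0 ≤ g 1 is the
  -- claim.
  let g : ℝ → ℝ := fun u => f (θ + u • v) - u * inner ℝ v (score pol θ s a)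
    + β / 2 * ‖v‖ ^ 2 * u ^ 2
  have hg : ∀ u, HasDerivAt g (inner ℝ (score pol (θ + u • v) s a) v
      - inner ℝ v (score pol θ s a) + β * ‖v‖ ^ 2 * u) u := by
    intro u
    have h1 : HasDerivAt (fun u : ℝ => θ + u • v) v u := by
      simpa using ((hasDerivAt_id u).smul_const v).const_add θ
    have h2 : HasDerivAt (fun u : ℝ => f (θ + u • v)) (inner ℝ (score pol (θ + u • v) s a) v) u := by
      have h := (hd (θ + u • v)).hasGradientAt.hasFDerivAt
      exact h.comp_hasDerivAt u h1
    have h3 := (h2.sub ((hasDerivAt_id u).mul_const (inner ℝ v (score pol θ s a)))).add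
      (((hasDerivAt_id u).pow 2).const_mul (β / 2 * ‖v‖ ^ 2))
    refine h3.congr_deriv ?_
    simp only [id]
    push_cast
    ring
  have hmono : MonotoneOn g (Set.Icc 0 1) := by
    refine monotoneOn_of_deriv_nonneg (convex_Icc 0 1)
      (fun u _ => (hg u).continuousAt.continuousWithinAt)
      (fun u _ => (hg u).differentiableAt.differentiableWithinAt) fun u hu => ?_
    rw [interior_Icc] at hu
    rw [(hg u).deriv, real_inner_comm, ← inner_sub_right]
    have h1 := (abs_le.1 (abs_real_inner_le_norm v
      (score pol (θ + u • v) s a - score pol θ s a))).1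
    have h2 := hL (θ + u • v) θ
    rw [add_sub_cancel_left, norm_smul, Real.norm_of_nonneg hu.1.le] at h2
    have h3 := mul_le_mul_of_nonneg_left h2 (norm_nonneg v)
    nlinarith
  have := hmono (Set.left_mem_Icc.2 zero_le_one) (Set.right_mem_Icc.2 zero_le_one) zero_le_one
  simp only [g, zero_smul, add_zero, zero_mul, sub_zero, one_smul, one_mul, one_pow, mul_one] at this
  simp only [hf] at this
  norm_num at this
  linarith

end Smoothness

/-! ### Progress of one NPG iteration -/

section Progress

variable {S A : Type*} [Fintype S] [Fintype A] {M : MDP S A} {d : ℕ} {pol : Param d → Policy S A}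
  {ν : PMF (S × A)} {W B α β : ℝ} {θ : Param d}

theorem sum_mul_le_sqrt {τ : Type*} [Fintype τ] {υ : τ → ℝ} (hυ : ∀ x, 0 ≤ υ x)
    (h1 : ∑ x, υ x = 1) (f : τ → ℝ) : ∑ x, υ x * f x ≤ √(∑ x, υ x * f x ^ 2) := by
  refine Real.le_sqrt_of_sq_le ?_
  set m := ∑ x, υ x * f x with hm
  have h : ∑ x, υ x * (f x - m) ^ 2 = (∑ x, υ x * f x ^ 2) - m ^ 2 := by
    have : ∀ x, υ x * (f x - m) ^ 2 = υ x * f x ^ 2 - 2 * m * (υ x * f x) + υ x * m ^ 2 :=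
      fun x => by ring
    simp_rw [this]
    rw [Finset.sum_add_distrib, Finset.sum_sub_distrib, ← Finset.mul_sum, ← Finset.sum_mul, ← hm, h1]
    ring
  have : 0 ≤ ∑ x, υ x * (f x - m) ^ 2 :=
    Finset.sum_nonneg fun x _ => mul_nonneg (hυ x) (sq_nonneg _)
  linarith

theorem dotProduct_fisher (υ : S × A → ℝ) (w : Param d) :
    dotProduct w.ofLp ((fisher pol θ υ).mulVec w.ofLp)
      = ∑ x, υ x * inner ℝ w (score pol θ x.1 x.2) ^ 2 := by
  unfold fisher
  rw [Matrix.sum_mulVec, dotProduct_sum]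
  refine Finset.sum_congr rfl fun x _ => ?_
  have e : inner ℝ w (score pol θ x.1 x.2)
      = dotProduct (score pol θ x.1 x.2).ofLp w.ofLp := by
    simp [EuclideanSpace.inner_eq_star_dotProduct]
  rw [Matrix.smul_mulVec, dotProduct_smul, Matrix.vecMulVec_mulVec, e]
  simp [dotProduct_comm w.ofLp, sq]

/-- Finiteness of the supremum rules out the case c/0 = ∞, so the bound survives a vanishing
denominator. Truncation by `ENNReal.ofReal` is harmless: a negative numerator satisfies the bound
anyway. -/
theorem dotProduct_mulVec_le_relCond {X Y : Matrix (Fin d) (Fin d) ℝ} (h : relCond X Y ≠ ⊤)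
    {w : Fin d → ℝ} (hY : 0 ≤ dotProduct w (Y.mulVec w)) :
    dotProduct w (X.mulVec w) ≤ (relCond X Y).toReal * dotProduct w (Y.mulVec w) := by
  have h1 : ENNReal.ofReal (dotProduct w (X.mulVec w)) / ENNReal.ofReal (dotProduct w (Y.mulVec w))
      ≤ relCond X Y := le_iSup (fun w : Fin d → ℝ => ENNReal.ofReal (dotProduct w (X.mulVec w))
        / ENNReal.ofReal (dotProduct w (Y.mulVec w))) w
  have h2 : ENNReal.ofReal (dotProduct w (X.mulVec w))
      ≤ relCond X Y * ENNReal.ofReal (dotProduct w (Y.mulVec w)) := by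
    refine (ENNReal.div_le_iff_le_mul (Or.inr h) (Or.inl ENNReal.ofReal_ne_top)).1 h1
  rw [← ENNReal.ofReal_toReal h, ← ENNReal.ofReal_mul ENNReal.toReal_nonneg,
    ENNReal.ofReal_le_ofReal_iff (mul_nonneg ENNReal.toReal_nonneg hY)] at h2
  exact h2

theorem sum_comparatorVisit (M : MDP S A) (π : Policy S A) (ρ : PMF S) :
    ∑ x, comparatorVisit M π ρ x = 1 := by
  simp_rw [comparatorVisit_eq_pairVisit]
  exact sum_pairVisit M π _

/-- The cross entropy of `π_θ` relative to `πstar`, averaged over the states visited by `πstar`. -/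
noncomputable def crossEntropy (M : MDP S A) (pol : Param d → Policy S A) (πstar : Policy S A)
    (ρ : PMF S) (θ : Param d) : ℝ :=
  ∑ x, comparatorVisit M πstar ρ x * -Real.log (pol θ x.1 x.2).toReal

variable {πstar : Policy S A} {ρ : PMF S}

theorem crossEntropy_nonneg (θ : Param d) : 0 ≤ crossEntropy M pol πstar ρ θ :=
  Finset.sum_nonneg fun x _ => mul_nonneg (comparatorVisit_nonneg M πstar ρ x)
    (neg_nonneg.2 (Real.log_nonpos ENNReal.toReal_nonneg (pmf_toReal_le_one _ _)))

theorem crossEntropy_of_uniform (h : ∀ s a, pol θ s a = (Fintype.card A : ℝ≥0∞)⁻¹) :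
    crossEntropy M pol πstar ρ θ = Real.log (Fintype.card A) := by
  unfold crossEntropy
  simp_rw [h, ENNReal.toReal_inv, ENNReal.toReal_natCast, Real.log_inv, neg_neg]
  rw [← Finset.sum_mul, sum_comparatorVisit, one_mul]

theorem SmoothPolicy.continuous_crossEntropy (h : SmoothPolicy β pol) :
    Continuous (crossEntropy M pol πstar ρ) :=
  continuous_finsetSum _ fun x _ => ((h x.1 x.2).2.1.continuous.neg).const_mul _

theorem SmoothPolicy.crossEntropy_add_le (h : SmoothPolicy β pol) (θ v : Param d) :
    crossEntropy M pol πstar ρ (θ + v) ≤ crossEntropy M pol πstar ρ θ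
      - ∑ x, comparatorVisit M πstar ρ x * inner ℝ v (score pol θ x.1 x.2) + β / 2 * ‖v‖ ^ 2 := by
  have e : β / 2 * ‖v‖ ^ 2 = ∑ x, comparatorVisit M πstar ρ x * (β / 2 * ‖v‖ ^ 2) := by
    rw [← Finset.sum_mul, sum_comparatorVisit, one_mul]
  unfold crossEntropy
  rw [e, ← Finset.sum_sub_distrib, ← Finset.sum_add_distrib]
  refine Finset.sum_le_sum fun x _ => ?_
  rw [← mul_sub, ← mul_add]
  exact mul_le_mul_of_nonneg_left (by linarith [h.log_add_ge θ v x.1 x.2])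
    (comparatorVisit_nonneg M πstar ρ x)

/-- The suboptimality of `π_θ` in terms of a direction `w` and the best fit `w₀`. -/
theorem suboptimality_le {w w₀ : Param d} (hw₀ : IsBestFit M pol ν W θ w₀) (hw : ‖w‖ ≤ W)
    (hK : relCond (fisher pol θ (comparatorVisit M πstar ρ))
      (fisher pol θ fun x => (ν x).toReal) ≠ ⊤) :
    (1 - M.γ) * (value M πstar ρ - value M (pol θ) ρ)
      ≤ ∑ x, comparatorVisit M πstar ρ x * inner ℝ w (score pol θ x.1 x.2)
        + √(lossA M pol w₀ θ (comparatorVisit M πstar ρ))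
        + √((relCond (fisher pol θ (comparatorVisit M πstar ρ))
            (fisher pol θ fun x => (ν x).toReal)).toReal / (1 - M.γ)
          * (lossA M pol w θ (pairVisit M (pol θ) ν)
            - lossA M pol w₀ θ (pairVisit M (pol θ) ν))) := by
  have hυ := comparatorVisit_nonneg M πstar ρ
  have hγ := one_sub_γ_pos M
  set K := relCond (fisher pol θ (comparatorVisit M πstar ρ)) (fisher pol θ fun x => (ν x).toReal)
  have h1 : ∑ x, comparatorVisit M πstar ρ x
      * (adv M (pol θ) x.1 x.2 - inner ℝ w₀ (score pol θ x.1 x.2))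
      ≤ √(lossA M pol w₀ θ (comparatorVisit M πstar ρ)) :=
    sum_mul_le_sqrt hυ (sum_comparatorVisit M πstar ρ) _
  have h2 := sum_mul_le_sqrt hυ (sum_comparatorVisit M πstar ρ)
    fun x => inner ℝ (w₀ - w) (score pol θ x.1 x.2)
  -- From ν to d_ν at the price of 1/(1-γ), then quadratic growth of the loss at its constrained
  -- minimizer.
  have h3 : ∑ x, (ν x).toReal * inner ℝ (w₀ - w) (score pol θ x.1 x.2) ^ 2
      ≤ (lossA M pol w θ (pairVisit M (pol θ) ν)
        - lossA M pol w₀ θ (pairVisit M (pol θ) ν)) / (1 - M.γ) := by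
    rw [le_div_iff₀ hγ, Finset.sum_mul]
    refine (Finset.sum_le_sum fun x _ => ?_).trans (hw₀.sum_sq_le hw)
    rw [mul_right_comm, mul_comm (ν x).toReal]
    exact mul_le_mul_of_nonneg_right (one_sub_γ_mul_le_pairVisit M _ ν x) (sq_nonneg _)
  have h4 := dotProduct_mulVec_le_relCond hK (w := (w₀ - w).ofLp) (by
    rw [dotProduct_fisher]
    exact Finset.sum_nonneg fun x _ => mul_nonneg ENNReal.toReal_nonneg (sq_nonneg _))
  rw [dotProduct_fisher, dotProduct_fisher] at h4
  have h5 := h4.trans (mul_le_mul_of_nonneg_left h3 ENNReal.toReal_nonneg)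
  rw [← mul_div_assoc, ← div_mul_eq_mul_div] at h5
  have h6 := h2.trans (Real.sqrt_le_sqrt h5)
  rw [← performance_difference]
  have e : ∑ x, comparatorVisit M πstar ρ x * adv M (pol θ) x.1 x.2
      = ∑ x, comparatorVisit M πstar ρ x * inner ℝ w (score pol θ x.1 x.2)
        + ∑ x, comparatorVisit M πstar ρ x
          * (adv M (pol θ) x.1 x.2 - inner ℝ w₀ (score pol θ x.1 x.2))
        + ∑ x, comparatorVisit M πstar ρ x * inner ℝ (w₀ - w) (score pol θ x.1 x.2) := by
    rw [← Finset.sum_add_distrib, ← Finset.sum_add_distrib]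
    refine Finset.sum_congr rfl fun x _ => ?_
    rw [inner_sub_left]
    ring
  rw [e]
  linarith

/-- The progress of one iteration of sample-based NPG, in expectation. -/
theorem mean_crossEntropy_step_le (h : SmoothPolicy β pol) (hβ : 0 < β) (hW : 0 < W) {η ε : ℝ}
    (hη : 0 ≤ η) {N : ℕ} (hN : 0 < N) {w₀ : Param d} (hw₀ : IsBestFit M pol ν W θ w₀)
    (hK : relCond (fisher pol θ (comparatorVisit M πstar ρ))
      (fisher pol θ fun x => (ν x).toReal) ≠ ⊤)
    (hε : mean (sgdLoop M pol ν W α θ N) (fun z =>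
        lossA M pol ((1 / (N : ℝ)) • z.sum) θ (pairVisit M (pol θ) ν)
          - lossA M pol w₀ θ (pairVisit M (pol θ) ν)) ≤ ε) :
    η * (1 - M.γ) * (value M πstar ρ - value M (pol θ) ρ)
      + mean (sgdLoop M pol ν W α θ N)
        (fun z => crossEntropy M pol πstar ρ (θ + η • ((1 / (N : ℝ)) • z.sum)))
      ≤ crossEntropy M pol πstar ρ θ + β / 2 * (η * W) ^ 2
        + η * (√(lossA M pol w₀ θ (comparatorVisit M πstar ρ))
          + √((relCond (fisher pol θ (comparatorVisit M πstar ρ))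
              (fisher pol θ fun x => (ν x).toReal)).toReal / (1 - M.γ) * ε)) := by
  set K := relCond (fisher pol θ (comparatorVisit M πstar ρ)) (fisher pol θ fun x => (ν x).toReal)
  set q := sgdLoop M pol ν W α θ N
  set c := K.toReal / (1 - M.γ)
  have hc : 0 ≤ c := div_nonneg ENNReal.toReal_nonneg (one_sub_γ_pos M).le
  set F : Param d → ℝ := fun w => lossA M pol w θ (pairVisit M (pol θ) ν)
    - lossA M pol w₀ θ (pairVisit M (pol θ) ν) with hF
  have hFc : Continuous F := (continuous_lossA _).sub continuous_const
  have hN' : (0 : ℝ) < N := Nat.cast_pos.2 hN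
  have hw : ∀ z ∈ q.support, ‖(1 / (N : ℝ)) • z.sum‖ ≤ W := by
    intro z hz
    rw [norm_smul, Real.norm_of_nonneg (by positivity), one_div, inv_mul_le_iff₀ hN']
    exact (mem_support_sgdLoop hW.le N hz).2
  have hmF : HasMean q fun z => c * F ((1 / (N : ℝ)) • z.sum) :=
    hasMean_sgdLoop hW.le N (f := fun p => c * F ((1 / (N : ℝ)) • p.2)) (by fun_prop)
  have hF0 : ∀ z ∈ q.support, 0 ≤ c * F ((1 / (N : ℝ)) • z.sum) := fun z hz =>
    mul_nonneg hc (sub_nonneg.2 (hw₀.2 _ (hw z hz)))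
  have hcc := h.continuous_crossEntropy (M := M) (πstar := πstar) (ρ := ρ)
  have hmΦ : HasMean q fun z => crossEntropy M pol πstar ρ (θ + η • ((1 / (N : ℝ)) • z.sum)) :=
    hasMean_sgdLoop hW.le N
      (f := fun p => crossEntropy M pol πstar ρ (θ + η • ((1 / (N : ℝ)) • p.2))) (by fun_prop)
  have hms := (hmF.sqrt hF0).const_mul η
  -- The SGD rate controls the mean excess loss, while the regret needs the mean of its square root.
  have hjensen : mean q (fun z => √(c * F ((1 / (N : ℝ)) • z.sum))) ≤ √(c * ε) :=
    mean_sqrt_le hF0 hmF (by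
      rw [mean_const_mul]
      exact mul_le_mul_of_nonneg_left hε hc)
  set L := √(lossA M pol w₀ θ (comparatorVisit M πstar ρ))
  have hpt : ∀ z ∈ q.support,
      crossEntropy M pol πstar ρ (θ + η • ((1 / (N : ℝ)) • z.sum))
        ≤ (crossEntropy M pol πstar ρ θ + β / 2 * (η * W) ^ 2 + η * L
          - η * (1 - M.γ) * (value M πstar ρ - value M (pol θ) ρ))
          + η * √(c * F ((1 / (N : ℝ)) • z.sum)) := by
    intro z hz
    have h1 := h.crossEntropy_add_le (M := M) (πstar := πstar) (ρ := ρ) θ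
      (η • ((1 / (N : ℝ)) • z.sum))
    have h2 := mul_le_mul_of_nonneg_left (suboptimality_le hw₀ (hw z hz) hK) hη
    simp_rw [real_inner_smul_left _ _ η, mul_left_comm _ η] at h1
    rw [← Finset.mul_sum] at h1
    have h3 : β / 2 * ‖η • ((1 / (N : ℝ)) • z.sum)‖ ^ 2 ≤ β / 2 * (η * W) ^ 2 := by
      rw [norm_smul, Real.norm_of_nonneg hη]
      exact mul_le_mul_of_nonneg_left (pow_le_pow_left₀ (by positivity)
        (mul_le_mul_of_nonneg_left (hw z hz) hη) 2) (by positivity)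
    rw [mul_add, mul_add, ← mul_assoc] at h2
    simp only [hF]
    linarith
  have := mean_mono hmΦ ((hasMean_const _ _).add hms) hpt
  rw [mean_add (hasMean_const _ _) hms, mean_const, mean_const_mul] at this
  have h4 := mul_le_mul_of_nonneg_left hjensen hη
  linarith

end Progress

/-! ### The Markov chain of iterates and the sample count -/

section Iterates

variable {S A : Type*} {M : MDP S A} {d : ℕ} {pol : Param d → Policy S A} {ν : PMF (S × A)}
  {W η α : ℝ} {N : ℕ}

/-- The law of the iterate `θ^{(t)}`. -/
noncomputable def iterateLaw (M : MDP S A) (pol : Param d → Policy S A) (ν : PMF (S × A))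
    (W η α : ℝ) (N t : ℕ) : PMF (Param d) :=
  (npg M pol ν W η α N t).map fun ω => ω.θ t

theorem iterateLaw_zero : iterateLaw M pol ν W η α N 0 = PMF.pure 0 := by
  rw [iterateLaw, npg, PMF.pure_map]

theorem iterateLaw_succ (t : ℕ) :
    iterateLaw M pol ν W η α N (t + 1) = (iterateLaw M pol ν W η α N t).bind fun θ =>
      (sgdLoop M pol ν W α θ N).map fun z => θ + η • ((1 / (N : ℝ)) • z.sum) := by
  rw [iterateLaw, npg, PMF.map_bind, iterateLaw, PMF.bind_map]
  congr 1
  funext ω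
  rw [PMF.map_comp]
  simp [Function.comp_def]

/-- Later iterations write only later entries of the run. Hypotheses about the whole run thereby
become statements about the chain θ^{(t)}. -/
theorem npg_map_iterate {t T : ℕ} (h : t ≤ T) :
    (npg M pol ν W η α N T).map (fun ω => ω.θ t) = iterateLaw M pol ν W η α N t := by
  induction T, h using Nat.le_induction with
  | base => rfl
  | succ T hT ih =>
    rw [← ih, npg, PMF.map_bind, ← PMF.bind_pure_comp]
    congr 1
    funext ω
    rw [PMF.map_comp]
    have e : (fun ω' : Run d => ω'.θ t) ∘ (fun z : SGDState d =>
        (⟨Function.update ω.θ (T + 1) (ω.θ T + η • ((1 / (N : ℝ)) • z.sum)),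
          ω.samples + z.samples⟩ : Run d)) = Function.const _ (ω.θ t) := by
      funext z
      simp [Function.update_of_ne (show t ≠ T + 1 by omega)]
    rw [e, PMF.map_const]
    rfl

theorem exists_of_mem_support_iterateLaw {t T : ℕ} (h : t ≤ T) {θ : Param d}
    (hθ : θ ∈ (iterateLaw M pol ν W η α N t).support) :
    ∃ ω ∈ (npg M pol ν W η α N T).support, ω.θ t = θ := by
  rwa [← npg_map_iterate h, PMF.mem_support_map_iff] at hθ

theorem norm_le_of_mem_support_iterateLaw (hW : 0 ≤ W) (hN : 0 < N) (t : ℕ) {θ : Param d}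
    (hθ : θ ∈ (iterateLaw M pol ν W η α N t).support) : ‖θ‖ ≤ t * (|η| * W) := by
  induction t generalizing θ with
  | zero =>
    rw [iterateLaw_zero, PMF.support_pure] at hθ
    obtain rfl : θ = 0 := hθ
    simp
  | succ t ih =>
    rw [iterateLaw_succ, PMF.mem_support_bind_iff] at hθ
    obtain ⟨θ', hθ', h⟩ := hθ
    rw [PMF.mem_support_map_iff] at h
    obtain ⟨z, hz, rfl⟩ := h
    have hN' : (0 : ℝ) < N := Nat.cast_pos.2 hN
    have h1 : ‖(1 / (N : ℝ)) • z.sum‖ ≤ W := by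
      rw [norm_smul, Real.norm_of_nonneg (by positivity), one_div, inv_mul_le_iff₀ hN']
      exact (mem_support_sgdLoop hW N hz).2
    refine (norm_add_le _ _).trans ?_
    rw [norm_smul, Real.norm_eq_abs]
    push_cast
    have := mul_le_mul_of_nonneg_left h1 (abs_nonneg η)
    linarith [ih hθ']

theorem hasMean_iterateLaw (hW : 0 ≤ W) (hN : 0 < N) (t : ℕ) {f : Param d → ℝ}
    (hf : Continuous f) : HasMean (iterateLaw M pol ν W η α N t) f := by
  obtain ⟨C, hC⟩ := (isCompact_closedBall (0 : Param d) (t * (|η| * W))).exists_bound_of_continuousOn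
    hf.continuousOn
  exact .of_bounded (c := C) fun θ hθ => hC _ (by
    simpa using norm_le_of_mem_support_iterateLaw hW hN t hθ)

theorem lmean_npg_samples (T : ℕ) :
    lmean (npg M pol ν W η α N T) (fun ω => (ω.samples : ℝ≥0∞))
      = ENNReal.ofReal (2 * N * T / (1 - M.γ)) := by
  have h : lmean (npg M pol ν W η α N T) (fun ω => (ω.samples : ℝ≥0∞))
      = T * (N * ENNReal.ofReal (2 / (1 - M.γ))) := by
    induction T with
    | zero => simp [npg, lmean_pure]
    | succ T ih =>
      rw [npg, lmean_bind]
      simp only [lmean_map, Nat.cast_add, lmean_add, lmean_const, lmean_sgdLoop_samples, ih]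
      push_cast
      ring
  rw [h, ← ENNReal.ofReal_natCast T, ← ENNReal.ofReal_natCast N,
    ← ENNReal.ofReal_mul N.cast_nonneg, ← ENNReal.ofReal_mul T.cast_nonneg]
  congr 1
  ring

end Iterates

/-! ### Telescoping, choice of step sizes and the final bound -/

section Regret

variable {S A : Type*} [Fintype S] [Fintype A] {M : MDP S A} {d : ℕ} {pol : Param d → Policy S A}
  {πstar : Policy S A} {ρ : PMF S} {ν : PMF (S × A)} {W B β η α ε κ εbias : ℝ} {N : ℕ}

theorem abs_value_sub_value_le (π π' : Policy S A) (ρ : PMF S) :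
    |value M π ρ - value M π' ρ| ≤ 1 / (1 - M.γ) :=
  abs_sub_le_iff.2 ⟨by linarith [value_le M π ρ, value_nonneg M π' ρ],
    by linarith [value_le M π' ρ, value_nonneg M π ρ]⟩

/-- The progress of iteration `t`, averaged over the law of `θ^{(t)}`. -/
theorem mean_crossEntropy_iterateLaw_succ_le (h : SmoothPolicy β pol) (hβ : 0 < β) (hW : 0 < W)
    (hη : 0 ≤ η) (hN : 0 < N) (hε0 : 0 ≤ ε) (hκ : 0 ≤ κ) (hbias : 0 ≤ εbias) (t : ℕ)
    {w₀ : Param d → Param d}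
    (hw₀ : ∀ θ ∈ (iterateLaw M pol ν W η α N t).support, IsBestFit M pol ν W θ (w₀ θ))
    (hε : ∀ θ ∈ (iterateLaw M pol ν W η α N t).support,
      mean (sgdLoop M pol ν W α θ N) (fun z =>
        lossA M pol ((1 / (N : ℝ)) • z.sum) θ (pairVisit M (pol θ) ν)
          - lossA M pol (w₀ θ) θ (pairVisit M (pol θ) ν)) ≤ ε)
    (hL : lmean (iterateLaw M pol ν W η α N t) (fun θ => ENNReal.ofReal
      (lossA M pol (w₀ θ) θ (comparatorVisit M πstar ρ))) ≤ ENNReal.ofReal εbias)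
    (hK : lmean (iterateLaw M pol ν W η α N t) (fun θ => relCond
      (fisher pol θ (comparatorVisit M πstar ρ)) (fisher pol θ (fun x => (ν x).toReal)))
        ≤ ENNReal.ofReal κ) :
    η * (1 - M.γ) * mean (iterateLaw M pol ν W η α N t)
        (fun θ => value M πstar ρ - value M (pol θ) ρ)
      + mean (iterateLaw M pol ν W η α N (t + 1)) (crossEntropy M pol πstar ρ)
      ≤ mean (iterateLaw M pol ν W η α N t) (crossEntropy M pol πstar ρ)
        + (β / 2 * (η * W) ^ 2 + η * (√εbias + √(κ / (1 - M.γ) * ε))) := by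
  have hγ := one_sub_γ_pos M
  set μ := iterateLaw M pol ν W η α N t with hμ
  have hcc := h.continuous_crossEntropy (M := M) (πstar := πstar) (ρ := ρ)
  have hΦ : HasMean μ (crossEntropy M pol πstar ρ) := hasMean_iterateLaw hW.le hN t hcc
  have hΦ' := hasMean_iterateLaw (M := M) (pol := pol) (ν := ν) (η := η) (α := α)
    hW.le hN (t + 1) hcc
  rw [iterateLaw_succ, ← hμ] at hΦ' ⊢
  have hΔ : HasMean μ fun θ => value M πstar ρ - value M (pol θ) ρ :=
    .of_bounded fun θ _ => abs_value_sub_value_le πstar (pol θ) ρ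
  set K : Param d → ℝ≥0∞ := fun θ => relCond (fisher pol θ (comparatorVisit M πstar ρ))
    (fisher pol θ fun x => (ν x).toReal) with hKdef
  -- A finite mean forces finiteness at every point of positive mass, so the real-valued bound for a
  -- single iteration applies there.
  have hKfin : ∀ θ ∈ μ.support, K θ ≠ ⊤ := fun θ hθ ht => by
    refine ENNReal.ofReal_ne_top (top_le_iff.1 (le_trans ?_ hK))
    refine (ENNReal.tsum_eq_top_of_eq_top ⟨θ, ?_⟩).ge
    rw [ht, ENNReal.mul_top hθ]
  have hKr : lmean μ (fun θ => ENNReal.ofReal (K θ).toReal) ≤ ENNReal.ofReal κ :=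
    (lmean_mono fun θ _ => ENNReal.ofReal_toReal_le).trans hK
  have hKm : HasMean μ fun θ => (K θ).toReal :=
    .of_lmean_le (fun _ _ => ENNReal.toReal_nonneg) hKr
  have hLn : ∀ θ, 0 ≤ lossA M pol (w₀ θ) θ (comparatorVisit M πstar ρ) :=
    fun θ => lossA_nonneg (comparatorVisit_nonneg M πstar ρ) _
  have hLm : HasMean μ fun θ => lossA M pol (w₀ θ) θ (comparatorVisit M πstar ρ) :=
    .of_lmean_le (fun _ _ => hLn _) hL
  have hs1 := mean_sqrt_le (fun _ _ => hLn _) hLm (mean_le_of_lmean_le (fun _ _ => hLn _) hbias hL)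
  have hKε : HasMean μ fun θ => (K θ).toReal / (1 - M.γ) * ε :=
    (hKm.const_mul (ε / (1 - M.γ))).mono fun θ _ => by
      have : 0 ≤ (K θ).toReal := ENNReal.toReal_nonneg
      rw [abs_of_nonneg (by positivity)]
      exact le_of_eq (by ring)
  have hKε0 : ∀ θ ∈ μ.support, 0 ≤ (K θ).toReal / (1 - M.γ) * ε := fun θ _ => by
    have : 0 ≤ (K θ).toReal := ENNReal.toReal_nonneg
    positivity
  -- The SGD bound ε is uniform in θ, so only the condition number is random and its mean suffices.
  have hs2 : mean μ (fun θ => √((K θ).toReal / (1 - M.γ) * ε)) ≤ √(κ / (1 - M.γ) * ε) := by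
    refine mean_sqrt_le hKε0 hKε ?_
    have e : ∀ θ, (K θ).toReal / (1 - M.γ) * ε = ε / (1 - M.γ) * (K θ).toReal := fun θ => by ring
    simp_rw [e]
    rw [mean_const_mul]
    refine (mul_le_mul_of_nonneg_left (mean_le_of_lmean_le
      (fun _ _ => ENNReal.toReal_nonneg) hκ hKr) (by positivity)).trans_eq (by ring)
  have hm1 : HasMean μ fun θ => √(lossA M pol (w₀ θ) θ (comparatorVisit M πstar ρ)) :=
    hLm.sqrt fun _ _ => hLn _
  have hm2 : HasMean μ fun θ => √((K θ).toReal / (1 - M.γ) * ε) := hKε.sqrt hKε0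
  have hpt : ∀ θ ∈ μ.support,
      η * (1 - M.γ) * (value M πstar ρ - value M (pol θ) ρ)
        + mean ((sgdLoop M pol ν W α θ N).map fun z => θ + η • ((1 / (N : ℝ)) • z.sum))
            (crossEntropy M pol πstar ρ)
      ≤ (crossEntropy M pol πstar ρ θ + β / 2 * (η * W) ^ 2)
        + η * (√(lossA M pol (w₀ θ) θ (comparatorVisit M πstar ρ))
          + √((K θ).toReal / (1 - M.γ) * ε)) := by
    intro θ hθ
    rw [mean_map (HasMean.map_iff.1 (hΦ'.of_bind hθ))]
    exact mean_crossEntropy_step_le h hβ hW hη hN (hw₀ θ hθ) (hKfin θ hθ) (hε θ hθ)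
  have := mean_mono ((hΔ.const_mul _).add hΦ'.bind_mean)
    ((hΦ.add (hasMean_const _ _)).add ((hm1.add hm2).const_mul η)) hpt
  rw [mean_add (hΔ.const_mul _) hΦ'.bind_mean, mean_const_mul, ← mean_bind hΦ',
    mean_add (hΦ.add (hasMean_const _ _)) ((hm1.add hm2).const_mul η),
    mean_add hΦ (hasMean_const _ _), mean_const, mean_const_mul, mean_add hm1 hm2] at this
  have h5 := mul_le_mul_of_nonneg_left (add_le_add hs1 hs2) hη
  linarith

theorem mean_inf'_le_average {τ : Type*} {p : PMF τ} {f : ℕ → τ → ℝ} {T : ℕ} (hT : 0 < T) {c : ℝ}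
    (hf : ∀ t x, |f t x| ≤ c) :
    mean p (fun x => (Finset.range T).inf' (Finset.nonempty_range_iff.mpr hT.ne') fun t => f t x)
      ≤ (∑ t ∈ Finset.range T, mean p (f t)) / T := by
  have hT' : (0 : ℝ) < T := Nat.cast_pos.2 hT
  have hm : ∀ t, HasMean p (f t) := fun t => .of_bounded fun x _ => hf t x
  have hi : HasMean p fun x =>
      (Finset.range T).inf' (Finset.nonempty_range_iff.mpr hT.ne') fun t => f t x := by
    refine .of_bounded (c := c) fun x _ => ?_
    obtain ⟨t, -, ht⟩ := Finset.exists_mem_eq_inf' (Finset.nonempty_range_iff.mpr hT.ne')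
      fun t => f t x
    rw [ht]
    exact hf t x
  rw [← mean_sum _ fun t _ => hm t, le_div_iff₀ hT', mul_comm, ← mean_const_mul]
  refine mean_mono (hi.const_mul _) (.sum _ fun t _ => hm t) fun x _ => ?_
  have := Finset.card_nsmul_le_sum (Finset.range T) (fun t => f t x)
    ((Finset.range T).inf' (Finset.nonempty_range_iff.mpr hT.ne') fun t => f t x)
    fun t ht => Finset.inf'_le (fun t => f t x) ht
  simpa using this

theorem sum_suboptimality_le {μ : ℕ → PMF (Param d)} {T : ℕ} {a C : ℝ}
    {Δ Φ : Param d → ℝ} (h : ∀ t < T, a * mean (μ t) Δ + mean (μ (t + 1)) Φ ≤ mean (μ t) Φ + C) :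
    a * ∑ t ∈ Finset.range T, mean (μ t) Δ + mean (μ T) Φ ≤ mean (μ 0) Φ + T * C := by
  induction T with
  | zero => simp
  | succ T ih =>
    have h1 := ih fun t ht => h t (by omega)
    have h2 := h T (by omega)
    rw [Finset.sum_range_succ]
    push_cast
    linarith

/-- This η gives L = Tβη²W²/2, so the initial potential equals the accumulated second-order terms.
Positivity of L is needed to divide by η. -/
theorem regret_algebra {L X E T : ℝ} (hβ : 0 < β) (hW : 0 < W) (hT : 0 < T) (hL : 0 < L)
    {γ' : ℝ} (hγ : 0 < γ')
    (hη : η = √(2 * L / (β * W ^ 2 * T)))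
    (h : η * γ' * X ≤ L + T * (β / 2 * (η * W) ^ 2 + η * E)) :
    X / T ≤ W / γ' * √(2 * β * L / T) + E / γ' := by
  have hη0 : 0 < η := hη ▸ Real.sqrt_pos.2 (by positivity)
  have hη2 : η ^ 2 = 2 * L / (β * W ^ 2 * T) := hη ▸ Real.sq_sqrt (by positivity)
  have hLη : L = η ^ 2 * (β * W ^ 2 * T) / 2 := by
    rw [hη2]
    field_simp
  have hs : √(2 * β * L / T) = β * W * η := by
    rw [Real.sqrt_eq_iff_mul_self_eq_of_pos (by positivity), hLη]
    field_simp
  have h1 : η * (γ' * X) ≤ η * (T * (β * W ^ 2 * η + E)) := by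
    linarith
  have h2 := le_of_mul_le_mul_left h1 hη0
  rw [hs, div_le_iff₀ hT]
  have e : (W / γ' * (β * W * η) + E / γ') * T = T * (β * W ^ 2 * η + E) / γ' := by
    field_simp
  rw [e, le_div_iff₀ hγ]
  linarith

theorem sqrt_statistical_error (hB : 0 ≤ B) (hW : 0 < W) (hκ : 0 ≤ κ) (hN : 0 < N) {γ' : ℝ}
    (hγ : 0 < γ') :
    √(κ / γ' * (8 * (B * W * (B * W + 1)) / (γ' * √N))) / γ'
      = √(8 * κ * B * W * (B * W + 1) / γ' ^ 4) * (1 / (N : ℝ) ^ (1 / 4 : ℝ)) := by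
  have hN' : (0 : ℝ) < N := Nat.cast_pos.2 hN
  have h4 : 0 < (N : ℝ) ^ (1 / 4 : ℝ) := Real.rpow_pos_of_pos hN' _
  have hs : √(N : ℝ) = ((N : ℝ) ^ (1 / 4 : ℝ)) ^ 2 := by
    rw [Real.sqrt_eq_rpow, ← Real.rpow_natCast, ← Real.rpow_mul hN'.le]
    norm_num
  rw [hs]
  generalize (N : ℝ) ^ (1 / 4 : ℝ) = y at h4
  have e : κ / γ' * (8 * (B * W * (B * W + 1)) / (γ' * y ^ 2))
      = (8 * κ * B * W * (B * W + 1) / γ' ^ 4) * (γ' / y) ^ 2 := by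
    field_simp
  have hp : 0 ≤ 8 * κ * B * W * (B * W + 1) / γ' ^ 4 := by positivity
  rw [e, Real.sqrt_mul hp, Real.sqrt_sq (by positivity)]
  field_simp

/-- The suboptimality of the best iterate of sample-based NPG. -/
theorem mean_best_iterate_le {T : ℕ} (hT : 0 < T) (hN : 0 < N) (hβ : 0 < β) (hW : 0 < W)
    {wstar : ℕ → Param d → Param d} (hκ : 0 ≤ κ) (hbias : 0 ≤ εbias) (hsm : SmoothPolicy β pol)
    (hunif : ∀ s a, pol 0 s a = (Fintype.card A : ℝ≥0∞)⁻¹)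
    (hη : η = √(2 * Real.log (Fintype.card A) / (β * W ^ 2 * T)))
    (hα : α = sgdStepSize M.γ W B N)
    (hB : ∀ ω ∈ (npg M pol ν W η α N T).support, ∀ t < T, ∀ s a, ‖score pol (ω.θ t) s a‖ ≤ B)
    (hbest : ∀ ω ∈ (npg M pol ν W η α N T).support, ∀ t < T,
      IsBestFit M pol ν W (ω.θ t) (wstar t (ω.θ t)))
    (htrans : ∀ t < T, lmean (npg M pol ν W η α N T) (fun ω => ENNReal.ofReal
      (lossA M pol (wstar t (ω.θ t)) (ω.θ t) (comparatorVisit M πstar ρ)))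
        ≤ ENNReal.ofReal εbias)
    (hcond : ∀ t < T, lmean (npg M pol ν W η α N T) (fun ω => relCond
      (fisher pol (ω.θ t) (comparatorVisit M πstar ρ))
      (fisher pol (ω.θ t) (fun x => (ν x).toReal))) ≤ ENNReal.ofReal κ) :
    mean (npg M pol ν W η α N T) (fun ω =>
        (Finset.range T).inf' (Finset.nonempty_range_iff.mpr hT.ne')
          (fun t => value M πstar ρ - value M (pol (ω.θ t)) ρ))
      ≤ W / (1 - M.γ) * √(2 * β * Real.log (Fintype.card A) / T)
        + √(8 * κ * B * W * (B * W + 1) / (1 - M.γ) ^ 4) * (1 / (N : ℝ) ^ (1 / 4 : ℝ))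
        + √εbias / (1 - M.γ) := by
  have hγ := one_sub_γ_pos M
  have hT' : (0 : ℝ) < T := Nat.cast_pos.2 hT
  obtain ⟨s₀, -⟩ := ρ.support_nonempty
  obtain ⟨a₀, -⟩ := (πstar s₀).support_nonempty
  -- B is an arbitrary real, but it bounds a norm: laws have nonempty support, so a run, a state and
  -- an action exist, and T > 0 gives the iterate at time 0.
  have hB0 : 0 ≤ B := by
    obtain ⟨ω, hω⟩ := (npg M pol ν W η α N T).support_nonempty
    exact (norm_nonneg _).trans (hB ω hω 0 hT s₀ a₀)
  set Δ : Param d → ℝ := fun θ => value M πstar ρ - value M (pol θ) ρ with hΔ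
  have hΔb : ∀ θ, |Δ θ| ≤ 1 / (1 - M.γ) := fun θ => abs_value_sub_value_le πstar (pol θ) ρ
  have hinf := mean_inf'_le_average (p := npg M pol ν W η α N T)
    (f := fun t ω => Δ (ω.θ t)) hT fun t ω => hΔb (ω.θ t)
  refine hinf.trans ?_
  set μ := iterateLaw M pol ν W η α N with hμ
  have hmap : ∀ t ∈ Finset.range T,
      mean (npg M pol ν W η α N T) (fun ω => Δ (ω.θ t)) = mean (μ t) Δ := by
    intro t ht
    rw [hμ, ← npg_map_iterate (Finset.mem_range.1 ht).le,
      mean_map (.of_bounded fun _ _ => hΔb _)]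
  rw [Finset.sum_congr rfl hmap]
  have hnA : 0 < Fintype.card A := Fintype.card_pos_iff.2 ⟨a₀⟩
  -- With a single action, log|A| = 0 and η = 0, so the potential argument is void; but then there
  -- is only one policy and every gap is zero.
  rcases (Nat.one_le_iff_ne_zero.2 hnA.ne').eq_or_lt with h1 | h1
  · have hsub : Subsingleton A := Fintype.card_le_one_iff_subsingleton.1 (by omega)
    have hpol : ∀ π : Policy S A, π = πstar := by
      intro π
      funext s
      have hu : ∀ p : PMF A, p = PMF.pure a₀ := by
        intro p
        rw [← PMF.map_id p, show (id : A → A) = Function.const A a₀ from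
          funext fun a => Subsingleton.elim _ _, PMF.map_const]
      rw [hu (π s), hu (πstar s)]
    have hz : Δ = fun _ => 0 := funext fun θ => by simp only [hΔ, hpol (pol θ), sub_self]
    simp only [hz, mean_const, Finset.sum_const_zero, zero_div]
    positivity
  · have hL : 0 < Real.log (Fintype.card A) := Real.log_pos (by exact_mod_cast h1)
    have hη0 : 0 ≤ η := hη ▸ Real.sqrt_nonneg _
    have hstep : ∀ t < T, _ := fun t ht =>
      mean_crossEntropy_iterateLaw_succ_le (M := M) (πstar := πstar) (ρ := ρ) (ν := ν) (α := α)
        (ε := 8 * (B * W * (B * W + 1)) / ((1 - M.γ) * √N)) hsm hβ hW hη0 hN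
        (by positivity) hκ hbias t (w₀ := wstar t)
        (fun θ hθ => by
          obtain ⟨ω, hω, rfl⟩ := exists_of_mem_support_iterateLaw ht.le hθ
          exact hbest ω hω t ht)
        (fun θ hθ => by
          obtain ⟨ω, hω, rfl⟩ := exists_of_mem_support_iterateLaw ht.le hθ
          subst hα
          exact mean_excess_lossA_sgdStepSize_le hW hB0 (hB ω hω t ht) (hbest ω hω t ht) hN)
        (by
          rw [← npg_map_iterate ht.le, lmean_map]
          exact htrans t ht)
        (by
          rw [← npg_map_iterate ht.le, lmean_map]
          exact hcond t ht)
    have hsum := sum_suboptimality_le hstep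
    rw [iterateLaw_zero, mean_pure, crossEntropy_of_uniform hunif] at hsum
    have hpos : 0 ≤ mean (μ T) (crossEntropy M pol πstar ρ) :=
      mean_nonneg fun θ => crossEntropy_nonneg θ
    have hreg := regret_algebra hβ hW hT' hL hγ hη
      ((le_add_of_nonneg_right hpos).trans hsum)
    refine hreg.trans_eq ?_
    rw [add_div, sqrt_statistical_error hB0 hW hκ hN hγ]
    ring

end Regret

end NPG

theorem mainTheorem11 (nA d T N : ℕ) (hT : 0 < T) (hN : 0 < N)
    (γ β W B : ℝ) (hβ : 0 < β) (hW : 0 < W) :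
    ∃ η α : ℝ, η = Real.sqrt (2 * Real.log nA / (β * W ^ 2 * T)) ∧ 0 < α ∧
      ∀ (S : Type*) (A : Type*) [Fintype S] [Fintype A] (M : NPG.MDP S A)
        (pol : NPG.Param d → NPG.Policy S A) (ρ : PMF S) (ν : PMF (S × A))
        (πstar : NPG.Policy S A) (wstar : ℕ → NPG.Param d → NPG.Param d)
        (κ εbias : ℝ),
        Fintype.card A = nA → M.γ = γ → 0 ≤ κ → 0 ≤ εbias →
        -- smooth policy class, with the uniform policy at the initial parameter
        NPG.SmoothPolicy β pol →
        (∀ s a, pol 0 s a = (Fintype.card A : ENNReal)⁻¹) →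
        -- the score is bounded along the run with probability one
        (∀ ω ∈ (NPG.npg M pol ν W η α N T).support, ∀ t < T, ∀ s a,
          ‖NPG.score pol (ω.θ t) s a‖ ≤ B) →
        -- `wstar t θ` is a minimizer of the compatible loss over the ball, at `θ = θ^{(t)}`
        (∀ ω ∈ (NPG.npg M pol ν W η α N T).support, ∀ t < T,
          NPG.IsBestFit M pol ν W (ω.θ t) (wstar t (ω.θ t))) →
        -- transfer error
        (∀ t < T, NPG.lmean (NPG.npg M pol ν W η α N T) (fun ω => ENNReal.ofReal
          (NPG.lossA M pol (wstar t (ω.θ t)) (ω.θ t) (NPG.comparatorVisit M πstar ρ)))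
            ≤ ENNReal.ofReal εbias) →
        -- average relative condition number
        (∀ t < T, NPG.lmean (NPG.npg M pol ν W η α N T) (fun ω => NPG.relCond
          (NPG.fisher pol (ω.θ t) (NPG.comparatorVisit M πstar ρ))
          (NPG.fisher pol (ω.θ t) (fun x => (ν x).toReal)))
            ≤ ENNReal.ofReal κ) →
        -- expected suboptimality of the best iterate
        NPG.mean (NPG.npg M pol ν W η α N T) (fun ω =>
            (Finset.range T).inf' (Finset.nonempty_range_iff.mpr hT.ne')
              (fun t => NPG.value M πstar ρ - NPG.value M (pol (ω.θ t)) ρ))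
          ≤ W / (1 - γ) * Real.sqrt (2 * β * Real.log nA / T)
            + Real.sqrt (8 * κ * B * W * (B * W + 1) / (1 - γ) ^ 4)
              * (1 / (N : ℝ) ^ (1 / 4 : ℝ))
            + Real.sqrt εbias / (1 - γ) ∧
        -- expected length of one episode
        (∀ θ : NPG.Param d, NPG.lmean (NPG.sampler M (pol θ) ν) (fun o => (o.samples : ENNReal))
          = ENNReal.ofReal (2 / (1 - γ))) ∧
        -- expected total number of samples
        NPG.lmean (NPG.npg M pol ν W η α N T) (fun ω => (ω.samples : ENNReal))
          = ENNReal.ofReal (2 * N * T / (1 - γ)) := by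
  -- The step sizes must be fixed before the decision process, so they are built from the numerical
  -- parameters alone; M.γ = γ links them to the process afterwards.
  refine ⟨_, NPG.sgdStepSize γ W B N, rfl, NPG.sgdStepSize_pos γ B hW N, ?_⟩
  intro S A _ _ M pol ρ ν πstar wstar κ εbias hA hγ hκ hbias hsm hunif hB hbest htrans hcond
  subst hγ hA
  exact ⟨NPG.mean_best_iterate_le hT hN hβ hW hκ hbias hsm hunif rfl rfl hB hbest htrans hcond,
    fun θ => NPG.lmean_sampler_samples M (pol θ) ν, NPG.lmean_npg_samples T⟩
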